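/- Let $K$ be a field, let $W\in\mathcal M_{m\times d}(\mathbb Z)$ be a matrix of positive type, i.e. $W$ has rank $m$ and some $\mathbb Z$-linear combination of its rows has only positive entries, and let $A=K[x_1,\dots,x_d]$ be $\mathbb Z^m$-graded by $W$: elements of $K$ have degree $0$ and $\deg x_j=c_j$ is the $j$-th column of $W$. For a graded $A$-module $M$ and $c\in\mathbb Z^m$ let $M(c)$ be the twist $M(c)_g=M_{g+c}$, let ${}^*\mathrm{Hom}_A(M,N)=\bigoplus_g \mathrm{Hom}_A(M,N)_g$ be the graded module spanned by the homogeneous homomorphisms, and let ${}^*\mathrm{Ext}^1_A$ be the first derived functor of ${}^*\mathrm{Hom}_A$ on graded modules. For $0\le t\le d$ put $F_t=(x_1,\dots,x_t)$, and let $Q_t=H^{d-t}_{\mathfrak m}(A/F_t)$ be the local cohomology module at $\mathfrak m=(x_1,\dots,x_d)$ with its natural grading (that of the Čech complex on $x_1,\dots,x_d$). Let $1\le t\le d-1$. Multiplication by $x_{t+1}$ on $Q_t$ fits into a short exact sequence of graded $A$-modules (with maps of degree $0$) $$0\longrightarrow Q_{t+1}(c_{t+1})\longrightarrow Q_t\xrightarrow{\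 \cdot x_{t+1}\ }Q_t(c_{t+1})\longrightarrow 0 .$$ For every such sequence (that is, for every choice of the first map that makes it exact) there is an isomorphism of graded $A$-modules $${}^*\mathrm{Ext}^1_A\bigl(Q_t(c_{t+1}),\,Q_{t+1}(c_{t+1})\bigr)\;\cong\;A/F_{t+1}$$ under which the class of the sequence corresponds to $1$; that is, the left-hand side is a graded free $A/F_{t+1}$-module of rank one generated by that class. Equivalently, without the twist in the second argument, ${}^*\mathrm{Ext}^1_A(Q_t(c_{t+1}),Q_{t+1})\cong (A/F_{t+1})(-c_{t+1})$ as graded modules; in particular it is isomorphic to $A/F_{t+1}$ when the grading is forgotten. -/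

import Mathlib

open MvPolynomial DirectSum

universe u

namespace GradedLC

/-- The weight of the variable `x_j`: the `j`-th column of the matrix `W`. -/
def wt {m d : ℕ} (W : Matrix (Fin m) (Fin d) ℤ) (j : Fin d) : Fin m → ℤ := fun i => W i j

/-- `W` has rank `m`, and some integral linear combination of its rows has only positive entries. -/
def IsPositiveType {m d : ℕ} (W : Matrix (Fin m) (Fin d) ℤ) : Prop :=
  (W.map (Int.cast : ℤ → ℚ)).rank = m ∧ ∃ a : Fin m → ℤ, ∀ j, 0 < ∑ i, a i * W i j

/-- The homogeneous component of degree `g` of `K[x_1, …, x_d]` graded by `W`. -/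
abbrev polyGr (K : Type u) [Field K] {m d : ℕ} (W : Matrix (Fin m) (Fin d) ℤ)
    (g : Fin m → ℤ) : Submodule K (MvPolynomial (Fin d) K) :=
  weightedHomogeneousSubmodule K (wt W) g

/-- A `W`-graded module over `A = K[x_1, …, x_d]`. -/
structure GrMod (K : Type u) [Field K] {m d : ℕ} (W : Matrix (Fin m) (Fin d) ℤ) where
  carrier : Type u
  [addCommGroup : AddCommGroup carrier]
  [module : Module (MvPolynomial (Fin d) K) carrier]
  gr : (Fin m → ℤ) → AddSubgroup carrier
  isInternal : DirectSum.IsInternal gr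
  smul_mem : ∀ {g h : Fin m → ℤ} {p : MvPolynomial (Fin d) K} {x : carrier},
    p ∈ polyGr K W g → x ∈ gr h → p • x ∈ gr (g + h)

attribute [instance] GrMod.addCommGroup GrMod.module

section Raw

variable {ι X : Type*} [DecidableEq ι] [AddCommGroup X]

theorem isInternal_of (gr : ι → AddSubgroup X)
    (ind : ∀ (s : Finset ι) (v : ι → X), (∀ g, v g ∈ gr g) → ∑ g ∈ s, v g = 0 →
      ∀ g ∈ s, v g = 0)
    (span : ∀ x, x ∈ ⨆ g, gr g) : DirectSum.IsInternal gr := by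
  classical
  refine ⟨?_, ?_⟩
  · rw [injective_iff_map_eq_zero]
    intro z hz
    rw [DirectSum.coeAddMonoidHom_eq_dfinsuppSum, DFinsupp.sum] at hz
    have := ind z.support (fun g => (z g : X)) (fun g => (z g).2) hz
    ext g
    by_cases hg : g ∈ z.support
    · simpa using this g hg
    · rw [DFinsupp.notMem_support_iff] at hg
      simp [hg]
  · intro x
    have hx := span x
    induction hx using AddSubgroup.iSup_induction' with
    | hp i x hx => exact ⟨DirectSum.of (fun i => gr i) i ⟨x, hx⟩, by simp⟩
    | h1 => exact ⟨0, by simp⟩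
    | hadd x y _ _ h1 h2 =>
      obtain ⟨a, rfl⟩ := h1
      obtain ⟨b, rfl⟩ := h2
      exact ⟨a + b, by simp⟩

theorem mem_iSup_of_isInternal {gr : ι → AddSubgroup X} (h : DirectSum.IsInternal gr) (x : X) :
    x ∈ ⨆ g, gr g := by
  classical
  obtain ⟨z, rfl⟩ := h.2 x
  rw [DirectSum.coeAddMonoidHom_eq_dfinsuppSum, DFinsupp.sum]
  exact AddSubgroup.sum_mem _ fun g _ => AddSubgroup.mem_iSup_of_mem g (z g).2

theorem ind_of_isInternal {gr : ι → AddSubgroup X} (h : DirectSum.IsInternal gr)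
    (s : Finset ι) (v : ι → X) (hv : ∀ g, v g ∈ gr g) (h0 : ∑ g ∈ s, v g = 0) :
    ∀ g ∈ s, v g = 0 := by
  classical
  intro g hg
  have hz : (∑ g ∈ s, DirectSum.of (fun i => gr i) g ⟨v g, hv g⟩) = 0 := by
    apply h.1
    simpa using h0
  have h1 := congrArg (fun z => (z g : X)) hz
  simp only [DirectSum.sum_apply, DirectSum.zero_apply, AddSubgroup.coe_zero,
    AddSubgroup.val_finsetSum] at h1
  rw [Finset.sum_eq_single g] at h1
  · simpa using h1
  · intro b _ hb
    rw [DirectSum.of_eq_of_ne _ _ _ hb.symm]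
    rfl
  · exact fun h => absurd hg h

end Raw

theorem polyGr_isInternal (K : Type u) [Field K] {m d : ℕ} (W : Matrix (Fin m) (Fin d) ℤ) :
    DirectSum.IsInternal (fun g => (polyGr K W g).toAddSubgroup) := by
  have h := (weightedDecomposition K (wt W)).isInternal
  exact h

namespace GrMod

variable {K : Type u} [Field K] {m d : ℕ} {W : Matrix (Fin m) (Fin d) ℤ}

noncomputable instance (M : GrMod K W) : DirectSum.Decomposition M.gr :=
  M.isInternal.chooseDecomposition

/-- Homomorphisms preserving degrees. -/
def IsGr {M N : GrMod K W} (f : M.carrier →ₗ[MvPolynomial (Fin d) K] N.carrier) : Prop :=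
  ∀ g x, x ∈ M.gr g → f x ∈ N.gr g

/-- Isomorphisms of `W`-graded modules. -/
structure Iso (M N : GrMod K W) where
  toEquiv : M.carrier ≃ₗ[MvPolynomial (Fin d) K] N.carrier
  mem_iff : ∀ g x, toEquiv x ∈ N.gr g ↔ x ∈ M.gr g

/-- The polynomial ring `A` as a graded module over itself. -/
@[reducible] noncomputable def poly (K : Type u) [Field K] {m d : ℕ} (W : Matrix (Fin m) (Fin d) ℤ) :
    GrMod K W where
  carrier := MvPolynomial (Fin d) K
  gr g := (polyGr K W g).toAddSubgroup
  isInternal := polyGr_isInternal K W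
  smul_mem := fun hp hx => IsWeightedHomogeneous.mul hp hx

theorem ind_add (M : GrMod K W) (c : Fin m → ℤ) (s : Finset (Fin m → ℤ))
    (v : (Fin m → ℤ) → M.carrier) (hv : ∀ g ∈ s, v g ∈ M.gr (g + c)) (h0 : ∑ g ∈ s, v g = 0) :
    ∀ g ∈ s, v g = 0 := by
  intro g hg
  have := ind_of_isInternal M.isInternal (s.map (Equiv.addRight c).toEmbedding)
    (fun g => if g - c ∈ s then v (g - c) else 0)
    (fun g => by
      by_cases h : g - c ∈ s
      · simpa [h] using hv (g - c) h
      · simp [h, zero_mem])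
    (by
      rw [Finset.sum_map, ← h0]
      exact Finset.sum_congr rfl fun g hg => by simp [hg]) (g + c)
    (by simpa using hg)
  simpa [hg] using this

/-- The twist `M(c)`, with `M(c)_g = M_{g + c}`. -/
@[reducible] noncomputable def shift (M : GrMod K W) (c : Fin m → ℤ) : GrMod K W where
  carrier := M.carrier
  gr g := M.gr (g + c)
  isInternal := by
    apply isInternal_of
    · exact fun s v hv h0 => ind_add M c s v (fun g _ => hv g) h0
    · intro x
      have := mem_iSup_of_isInternal M.isInternal x
      rwa [← (Equiv.addRight c).iSup_comp] at this
  smul_mem := by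
    intro g h p x hp hx
    rw [add_assoc]
    exact M.smul_mem hp hx

/-- Multiplication by a polynomial `p`, as a map `M → M(c)`. -/
noncomputable def mulShift (M : GrMod K W) (p : MvPolynomial (Fin d) K) (c : Fin m → ℤ) :
    M.carrier →ₗ[MvPolynomial (Fin d) K] (M.shift c).carrier :=
  LinearMap.lsmul (MvPolynomial (Fin d) K) M.carrier p

theorem decompose_sum_of_mem (M : GrMod K W) (s : Finset (Fin m → ℤ)) (v : (Fin m → ℤ) → M.carrier)
    (hv : ∀ g, v g ∈ M.gr g) (g : Fin m → ℤ) (hg : g ∈ s) :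
    (decompose M.gr (∑ h ∈ s, v h) g : M.carrier) = v g := by
  rw [decompose_sum, DirectSum.sum_apply, AddSubgroup.val_finsetSum, Finset.sum_eq_single g]
  · exact decompose_of_mem_same _ (hv g)
  · intro b _ hb
    exact decompose_of_mem_ne _ (hv b) hb
  · exact fun h => absurd hg h

theorem decompose_map {M N : GrMod K W} {f : M.carrier →ₗ[MvPolynomial (Fin d) K] N.carrier}
    (hf : IsGr f) (x : M.carrier) (g : Fin m → ℤ) :
    (decompose N.gr (f x) g : N.carrier) = f (decompose M.gr x g) := by
  induction x using DirectSum.Decomposition.inductionOn M.gr with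
  | zero => simp
  | @homogeneous i x =>
    by_cases h : i = g
    · subst h
      rw [decompose_of_mem_same _ x.2, decompose_of_mem_same _ (hf _ _ x.2)]
    · rw [decompose_of_mem_ne _ x.2 h, decompose_of_mem_ne _ (hf _ _ x.2) h, map_zero]
  | add a b ha hb => simp [decompose_add, ha, hb]

theorem isHomogeneous_comap {M N : GrMod K W}
    {f : M.carrier →ₗ[MvPolynomial (Fin d) K] N.carrier} (hf : IsGr f)
    {S : Submodule (MvPolynomial (Fin d) K) N.carrier} (hS : S.IsHomogeneous N.gr) :
    (S.comap f).IsHomogeneous M.gr := by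
  intro g x hx
  rw [Submodule.mem_comap, ← decompose_map hf]
  exact hS g hx

theorem isHomogeneous_ker {M N : GrMod K W}
    {f : M.carrier →ₗ[MvPolynomial (Fin d) K] N.carrier} (hf : IsGr f) :
    (LinearMap.ker f).IsHomogeneous M.gr := by
  intro g x hx
  rw [LinearMap.mem_ker, ← decompose_map hf, LinearMap.mem_ker.1 hx]
  simp

theorem isHomogeneous_range {M N : GrMod K W}
    {f : M.carrier →ₗ[MvPolynomial (Fin d) K] N.carrier} (hf : IsGr f) :
    (LinearMap.range f).IsHomogeneous N.gr := by
  rintro g _ ⟨x, rfl⟩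
  exact ⟨_, (decompose_map hf x g).symm⟩

theorem smul_mem_iSup {X : Type*} [AddCommGroup X] [Module (MvPolynomial (Fin d) K) X]
    {gr : (Fin m → ℤ) → AddSubgroup X}
    (hgr : ∀ {g h : Fin m → ℤ} {p : MvPolynomial (Fin d) K} {x : X},
      p ∈ polyGr K W g → x ∈ gr h → p • x ∈ gr (g + h))
    (p : MvPolynomial (Fin d) K) {x : X} (hx : x ∈ ⨆ g, gr g) : p • x ∈ ⨆ g, gr g := by
  induction hx using AddSubgroup.iSup_induction' with
  | h1 => simp
  | hadd x y _ _ h1 h2 => rw [smul_add]; exact add_mem h1 h2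
  | hp i x hx =>
    have hp := mem_iSup_of_isInternal (polyGr_isInternal K W) p
    induction hp using AddSubgroup.iSup_induction' with
    | h1 => simp
    | hadd a b _ _ h1 h2 => rw [add_smul]; exact add_mem h1 h2
    | hp j p hp => exact AddSubgroup.mem_iSup_of_mem (j + i) (hgr hp hx)

theorem isHomogeneous_span (M : GrMod K W) (T : Set M.carrier)
    (hT : ∀ x ∈ T, ∃ g, x ∈ M.gr g) :
    (Submodule.span (MvPolynomial (Fin d) K) T).IsHomogeneous M.gr := by
  have key : ∀ x ∈ Submodule.span (MvPolynomial (Fin d) K) T,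
      x ∈ ⨆ g, (M.gr g ⊓ (Submodule.span (MvPolynomial (Fin d) K) T).toAddSubgroup) := by
    intro x hx
    induction hx using Submodule.span_induction with
    | mem x hx =>
      obtain ⟨g, hg⟩ := hT x hx
      exact AddSubgroup.mem_iSup_of_mem g ⟨hg, Submodule.subset_span hx⟩
    | zero => exact zero_mem _
    | add x y _ _ h1 h2 => exact add_mem h1 h2
    | smul p x _ h =>
      exact smul_mem_iSup (W := W)
        (gr := fun g => M.gr g ⊓ (Submodule.span (MvPolynomial (Fin d) K) T).toAddSubgroup)
        (fun hp hx => ⟨M.smul_mem hp hx.1, Submodule.smul_mem _ _ hx.2⟩) p h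
  intro g x hx
  have hx' := key x hx
  clear hx
  induction hx' using AddSubgroup.iSup_induction' with
  | h1 => simp
  | hadd x y _ _ h1 h2 =>
    rw [decompose_add]
    exact add_mem h1 h2
  | hp i x hx =>
    by_cases h : i = g
    · subst h
      rw [decompose_of_mem_same M.gr hx.1]
      exact hx.2
    · rw [decompose_of_mem_ne M.gr hx.1 h]
      exact zero_mem _

/-- A homogeneous submodule, with the induced grading. -/
@[reducible] noncomputable def sub (M : GrMod K W) (S : Submodule (MvPolynomial (Fin d) K) M.carrier)
    (hS : S.IsHomogeneous M.gr) : GrMod K W where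
  carrier := S
  gr g := (M.gr g).comap S.subtype.toAddMonoidHom
  isInternal := by
    apply isInternal_of
    · intro s v hv h0 g hg
      have := ind_of_isInternal M.isInternal s (fun g => (v g : M.carrier)) hv
        (by simpa using congrArg Subtype.val h0) g hg
      exact Subtype.ext this
    · classical
      intro x
      have hx : x = ∑ g ∈ (decompose M.gr (x : M.carrier)).support,
          (⟨(decompose M.gr (x : M.carrier) g : M.carrier), hS g x.2⟩ : S) := by
        apply Subtype.ext
        rw [AddSubmonoidClass.coe_finsetSum]
        exact (sum_support_decompose M.gr (x : M.carrier)).symm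
      rw [hx]
      refine AddSubgroup.sum_mem _ fun g _ => AddSubgroup.mem_iSup_of_mem g ?_
      exact (decompose M.gr (x : M.carrier) g).2
  smul_mem := fun hp hx => M.smul_mem hp hx

/-- The quotient by a homogeneous submodule, with the induced grading. -/
@[reducible] noncomputable def quot (M : GrMod K W) (S : Submodule (MvPolynomial (Fin d) K) M.carrier)
    (hS : S.IsHomogeneous M.gr) : GrMod K W where
  carrier := M.carrier ⧸ S
  gr g := (M.gr g).map S.mkQ.toAddMonoidHom
  isInternal := by
    apply isInternal_of
    · intro s v hv h0 g hg
      choose w hw hwv using hv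
      have h1 : ∑ g ∈ s, w g ∈ S := by
        rw [← Submodule.Quotient.mk_eq_zero, ← Submodule.mkQ_apply, map_sum, ← h0]
        exact Finset.sum_congr rfl fun g _ => hwv g
      have h2 := hS g h1
      rw [decompose_sum_of_mem M s w hw g hg] at h2
      rw [← hwv g]
      exact (Submodule.Quotient.mk_eq_zero S).2 h2
    · intro x
      obtain ⟨x, rfl⟩ := S.mkQ_surjective x
      rw [← AddSubgroup.map_iSup]
      exact ⟨x, mem_iSup_of_isInternal M.isInternal x, rfl⟩
  smul_mem := by
    rintro g h p _ hp ⟨x, hx, rfl⟩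
    exact ⟨p • x, M.smul_mem hp hx, rfl⟩

/-- Finite direct sums. -/
@[reducible] noncomputable def pi {ι : Type} [Finite ι] (M : ι → GrMod K W) : GrMod K W where
  carrier := ∀ i, (M i).carrier
  gr g :=
    { carrier := {x | ∀ i, x i ∈ (M i).gr g}
      zero_mem' := fun _ => zero_mem _
      add_mem' := fun h1 h2 i => add_mem (h1 i) (h2 i)
      neg_mem' := fun h1 i => neg_mem (h1 i) }
  isInternal := by
    apply isInternal_of
    · intro s v hv h0 g hg
      funext i
      exact ind_of_isInternal (M i).isInternal s (fun g => v g i) (fun g => hv g i)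
        (by simpa using congrFun h0 i) g hg
    · classical
      intro x
      have := Fintype.ofFinite ι
      rw [← Finset.univ_sum_single x]
      refine AddSubgroup.sum_mem _ fun i _ => ?_
      have hx := mem_iSup_of_isInternal (M i).isInternal (x i)
      have : (AddMonoidHom.single (fun i => (M i).carrier) i) (x i) ∈
          (⨆ g, (M i).gr g).map (AddMonoidHom.single (fun i => (M i).carrier) i) := ⟨_, hx, rfl⟩
      rw [AddSubgroup.map_iSup] at this
      have hle : (⨆ g, ((M i).gr g).map (AddMonoidHom.single (fun i => (M i).carrier) i)) ≤
          ⨆ g, ({ carrier := {x | ∀ i, x i ∈ (M i).gr g}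
                  zero_mem' := fun _ => zero_mem _
                  add_mem' := fun h1 h2 i => add_mem (h1 i) (h2 i)
                  neg_mem' := fun h1 i => neg_mem (h1 i) } : AddSubgroup (∀ i, (M i).carrier)) := by
        refine iSup_mono fun g => ?_
        rintro _ ⟨y, hy, rfl⟩ j
        by_cases h : j = i
        · subst h
          simpa using hy
        · simp [Pi.single_eq_of_ne h, zero_mem]
      exact hle this
  smul_mem := fun hp hx i => (M i).smul_mem hp (hx i)

theorem mem_pi_gr {ι : Type} [Finite ι] {M : ι → GrMod K W} {g : Fin m → ℤ}
    {x : ∀ i, (M i).carrier} : x ∈ (pi M).gr g ↔ ∀ i, x i ∈ (M i).gr g :=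
  Iff.rfl

section Localization

/-- `s ^ n` as an element of the monoid of powers of `s`. -/
def spow {R : Type u} [CommRing R] (s : R) (n : ℕ) : Submonoid.powers s :=
  ⟨s ^ n, pow_mem (Submonoid.mem_powers s) n⟩

theorem mk_add {R X : Type u} [CommRing R] [AddCommGroup X] [Module R X] {T : Submonoid R}
    (x y : X) (a : T) :
    LocalizedModule.mk (x + y) a = LocalizedModule.mk x a + LocalizedModule.mk y a := by
  rw [LocalizedModule.mk_add_mk, ← smul_add, LocalizedModule.mk_cancel_common_left]

theorem mk_sum {R X ι : Type*} [CommRing R] [AddCommGroup X] [Module R X] {T : Submonoid R}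
    (t : Finset ι) (x : ι → X) (a : T) :
    LocalizedModule.mk (∑ i ∈ t, x i) a = ∑ i ∈ t, LocalizedModule.mk (x i) a := by
  classical
  induction t using Finset.induction_on with
  | empty => simp
  | insert i t hi ih =>
    rw [Finset.sum_insert hi, Finset.sum_insert hi, ← ih, LocalizedModule.mk_add_mk, ← smul_add,
      LocalizedModule.mk_cancel_common_left]

/-- The localization of `M` at the powers of a homogeneous element `s` of degree `e`:
`m / s ^ n` has degree `deg m - n e`. -/
@[reducible] noncomputable def loc (M : GrMod K W) (s : MvPolynomial (Fin d) K) (e : Fin m → ℤ)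
    (hs : s ∈ polyGr K W e) : GrMod K W where
  carrier := LocalizedModule (Submonoid.powers s) M.carrier
  gr g :=
    { carrier := {z | ∃ (n : ℕ) (x : M.carrier), x ∈ M.gr (g + n • e) ∧
        z = LocalizedModule.mk x (spow s n)}
      zero_mem' := ⟨0, 0, zero_mem _, (LocalizedModule.zero_mk _).symm⟩
      add_mem' := by
        rintro _ _ ⟨n, x, hx, rfl⟩ ⟨k, y, hy, rfl⟩
        refine ⟨n + k, s ^ k • x + s ^ n • y, add_mem ?_ ?_, ?_⟩
        · have := M.smul_mem (IsWeightedHomogeneous.pow hs k) hx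
          convert this using 2
          rw [add_smul]; abel
        · have := M.smul_mem (IsWeightedHomogeneous.pow hs n) hy
          convert this using 2
          rw [add_smul]; abel
        · rw [LocalizedModule.mk_add_mk]
          congr 1
          exact Subtype.ext (pow_add s n k).symm
      neg_mem' := by
        rintro _ ⟨n, x, hx, rfl⟩
        exact ⟨n, -x, neg_mem hx, LocalizedModule.mk_neg.symm⟩ }
  isInternal := by
    apply isInternal_of
    · intro t v hv h0 g hg
      choose n x hx hv using hv
      have hN : ∀ h ∈ t, n h ≤ ∑ h ∈ t, n h := fun h hh =>
        Finset.single_le_sum (f := n) (fun _ _ => Nat.zero_le _) hh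
      set N := ∑ h ∈ t, n h with hNdef
      have hv' : ∀ h ∈ t, v h = LocalizedModule.mk (s ^ (N - n h) • x h) (spow s N) := by
        intro h hh
        have : spow s N = spow s (N - n h) * spow s (n h) := by
          apply Subtype.ext
          change s ^ N = s ^ (N - n h) * s ^ (n h)
          rw [← pow_add, Nat.sub_add_cancel (hN h hh)]
        rw [hv h, this]
        exact (LocalizedModule.mk_cancel_common_left (spow s (N - n h)) (spow s (n h)) (x h)).symm
      rw [Finset.sum_congr rfl hv', ← mk_sum, ← LocalizedModule.zero_mk (spow s N),
        LocalizedModule.mk_eq] at h0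
      obtain ⟨⟨_, k, rfl⟩, hu⟩ := h0
      simp only [smul_zero] at hu
      have hu' : ∑ h ∈ t, s ^ (k + N) • (s ^ (N - n h) • x h) = 0 := by
        rw [← Finset.smul_sum, pow_add, mul_smul]
        exact hu
      have hz := ind_add M ((k + N + N) • e) t (fun h => s ^ (k + N) • (s ^ (N - n h) • x h))
        (fun h hh => by
          have := M.smul_mem (IsWeightedHomogeneous.pow hs (k + N))
            (M.smul_mem (IsWeightedHomogeneous.pow hs (N - n h)) (hx h))
          convert this using 2
          have h1 : (N - n h) • e + n h • e = N • e := by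
            rw [← add_smul, Nat.sub_add_cancel (hN h hh)]
          rw [add_smul (k + N), ← h1]; abel) hu' g hg
      rw [hv' g hg, ← LocalizedModule.zero_mk (spow s N), LocalizedModule.mk_eq]
      refine ⟨spow s (k + N), ?_⟩
      have hz' : spow s (k + N) • (s ^ (N - n g) • x g) = 0 := hz
      rw [smul_comm, hz']
      simp
    · intro z
      induction z using LocalizedModule.induction_on with
      | h x a =>
        obtain ⟨_, n, rfl⟩ := a
        have hx := mem_iSup_of_isInternal M.isInternal x
        induction hx using AddSubgroup.iSup_induction' with
        | h1 =>
          change LocalizedModule.mk 0 (spow s n) ∈ _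
          rw [LocalizedModule.zero_mk (spow s n)]
          exact zero_mem _
        | hadd x y _ _ h1 h2 =>
          rw [mk_add]
          exact add_mem h1 h2
        | hp i x hx =>
          exact AddSubgroup.mem_iSup_of_mem (i - n • e) ⟨n, x, by rwa [sub_add_cancel], rfl⟩
  smul_mem := by
    rintro g h p _ hp ⟨n, x, hx, rfl⟩
    refine ⟨n, p • x, ?_, LocalizedModule.smul'_mk _ _ _⟩
    rw [add_assoc]
    exact M.smul_mem hp hx

end Localization

section LocalCohomology

/-- The monomial `∏_{j ∈ S} x_j`. -/
noncomputable def xS (K : Type u) [Field K] {d : ℕ} (S : Finset (Fin d)) : MvPolynomial (Fin d) K :=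
  ∏ j ∈ S, X j

theorem xS_mem (S : Finset (Fin d)) : xS K S ∈ polyGr K W (∑ j ∈ S, wt W j) :=
  IsWeightedHomogeneous.prod S _ _ fun j _ => isWeightedHomogeneous_X K (wt W) j

/-- The localization `M[1 / ∏_{j ∈ S} x_j]`. -/
@[reducible] noncomputable def cechTerm (M : GrMod K W) (S : Finset (Fin d)) : GrMod K W :=
  M.loc (xS K S) (∑ j ∈ S, wt W j) (xS_mem S)

theorem isUnit_of_subset (M : GrMod K W) {S T : Finset (Fin d)} (h : S ⊆ T)
    (a : Submonoid.powers (xS K S)) :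
    IsUnit (algebraMap (MvPolynomial (Fin d) K)
      (Module.End (MvPolynomial (Fin d) K)
        (LocalizedModule (Submonoid.powers (xS K T)) M.carrier)) a) := by
  obtain ⟨_, n, rfl⟩ := a
  have h1 : IsUnit (algebraMap (MvPolynomial (Fin d) K)
      (Module.End (MvPolynomial (Fin d) K)
        (LocalizedModule (Submonoid.powers (xS K T)) M.carrier)) (xS K T)) :=
    IsLocalizedModule.map_units (LocalizedModule.mkLinearMap (Submonoid.powers (xS K T)) M.carrier)
      ⟨xS K T, Submonoid.mem_powers _⟩
  have h2 : xS K S ∣ xS K T := Finset.prod_dvd_prod_of_subset _ _ _ h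
  have h3 : IsUnit (algebraMap (MvPolynomial (Fin d) K)
      (Module.End (MvPolynomial (Fin d) K)
        (LocalizedModule (Submonoid.powers (xS K T)) M.carrier)) (xS K S)) := by
    obtain ⟨q, hq⟩ := h2
    rw [show algebraMap (MvPolynomial (Fin d) K)
      (Module.End (MvPolynomial (Fin d) K)
        (LocalizedModule (Submonoid.powers (xS K T)) M.carrier)) (xS K T) = _ from
        (congrArg _ hq).trans (map_mul _ _ _)] at h1
    refine ((Commute.isUnit_mul_iff ?_).1 h1).1
    rw [Commute, SemiconjBy, ← map_mul, ← map_mul, mul_comm]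
  change IsUnit (algebraMap _ _ (xS K S ^ n))
  rw [map_pow]
  exact h3.pow n

/-- The canonical map `M[1 / ∏_{j ∈ S} x_j] → M[1 / ∏_{j ∈ T} x_j]` for `S ⊆ T`. -/
noncomputable def cechRes (M : GrMod K W) {S T : Finset (Fin d)} (h : S ⊆ T) :
    (M.cechTerm S).carrier →ₗ[MvPolynomial (Fin d) K] (M.cechTerm T).carrier :=
  LocalizedModule.lift (Submonoid.powers (xS K S))
    (LocalizedModule.mkLinearMap (Submonoid.powers (xS K T)) M.carrier) (M.isUnit_of_subset h)

theorem cechRes_isGr (M : GrMod K W) {S T : Finset (Fin d)} (h : S ⊆ T) :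
    IsGr (M.cechRes h) := by
  rintro g _ ⟨n, x, hx, rfl⟩
  refine ⟨n, xS K (T \ S) ^ n • x, ?_, ?_⟩
  · have := M.smul_mem (IsWeightedHomogeneous.pow (xS_mem (K := K) (W := W) (T \ S)) n) hx
    convert this using 2
    rw [← Finset.sum_sdiff h, smul_add]; abel
  · change LocalizedModule.lift _ _ _ _ = _
    rw [LocalizedModule.lift_mk, Module.End.algebraMap_isUnit_inv_apply_eq_iff,
      LocalizedModule.mkLinearMap_apply, LocalizedModule.smul'_mk, smul_smul]
    have : xS K T ^ n = (xS K S ^ n) * xS K (T \ S) ^ n := by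
      rw [← mul_pow, mul_comm, xS, xS, xS, Finset.prod_sdiff h]
    change _ = LocalizedModule.mk ((xS K S ^ n * xS K (T \ S) ^ n) • x) _
    rw [← this]
    exact (LocalizedModule.mk_cancel (spow (xS K T) n) x).symm

/-- The degree `i` term of the Čech complex of `M` on `x_1, …, x_d`: the direct sum of the
localizations `M[1 / ∏_{j ∈ S} x_j]` over the sets `S` of `i` indices. -/
@[reducible] noncomputable def cech (M : GrMod K W) (i : ℤ) : GrMod K W :=
  pi fun S : {S : Finset (Fin d) // (S.card : ℤ) = i} => M.cechTerm S.1

theorem card_erase_eq {i j : ℤ} (h : i + 1 = j) {T : Finset (Fin d)} (hT : (T.card : ℤ) = j)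
    {k : Fin d} (hk : k ∈ T) : ((T.erase k).card : ℤ) = i := by
  have := Finset.card_erase_add_one hk
  omega

/-- The Čech differential: the component of `D f` at `T` is the sum over `k ∈ T` of the images of
`f (T \ {k})`, with sign `(-1) ^ #{l ∈ T | l < k}`. -/
noncomputable def cechD (M : GrMod K W) {i j : ℤ} (h : i + 1 = j) :
    (M.cech i).carrier →ₗ[MvPolynomial (Fin d) K] (M.cech j).carrier :=
  LinearMap.pi fun T : {T : Finset (Fin d) // (T.card : ℤ) = j} =>
    ∑ k : {k : Fin d // k ∈ T.1}, ((-1 : ℤ) ^ (T.1.filter (· < k.1)).card) •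
      ((M.cechRes (Finset.erase_subset k.1 T.1)).comp
        (LinearMap.proj (R := MvPolynomial (Fin d) K)
          (φ := fun S : {S : Finset (Fin d) // (S.card : ℤ) = i} => (M.cechTerm S.1).carrier) ⟨T.1.erase k.1, card_erase_eq h T.2 k.2⟩))

theorem cechD_apply (M : GrMod K W) {i j : ℤ} (h : i + 1 = j) (f : (M.cech i).carrier)
    (T : {T : Finset (Fin d) // (T.card : ℤ) = j}) :
    M.cechD h f T = ∑ k : {k : Fin d // k ∈ T.1}, ((-1 : ℤ) ^ (T.1.filter (· < k.1)).card) •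
      M.cechRes (Finset.erase_subset k.1 T.1) (f ⟨T.1.erase k.1, card_erase_eq h T.2 k.2⟩) := by
  unfold cechD
  exact LinearMap.sum_apply _ _ _

theorem cechD_isGr (M : GrMod K W) {i j : ℤ} (h : i + 1 = j) : IsGr (M.cechD h) := by
  intro g f hf
  rw [mem_pi_gr] at hf
  refine mem_pi_gr.2 fun T => ?_
  have key : M.cechD h f T ∈ (M.cechTerm T.1).gr g := by
    rw [cechD_apply]
    refine AddSubgroup.sum_mem _ fun k _ => ?_
    have h1 := hf ⟨T.1.erase k.1, card_erase_eq h T.2 k.2⟩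
    have h2 := M.cechRes_isGr (Finset.erase_subset k.1 T.1) g _ h1
    exact AddSubgroup.zsmul_mem _ h2 _
  exact key

/-- The cocycles of degree `i` of the Čech complex. -/
@[reducible] noncomputable def cocycles (M : GrMod K W) (i : ℤ) : GrMod K W :=
  (M.cech i).sub (LinearMap.ker (M.cechD (rfl : i + 1 = i + 1))) (isHomogeneous_ker (M.cechD_isGr _))

theorem sub_subtype_isGr (M : GrMod K W) (S : Submodule (MvPolynomial (Fin d) K) M.carrier)
    (hS : S.IsHomogeneous M.gr) : IsGr (M := M.sub S hS) (N := M) S.subtype :=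
  fun _ _ hx => hx

/-- The `i`-th graded local cohomology module `H^i_𝔪(M)`, for `𝔪 = (x_1, …, x_d)`:
the `i`-th cohomology of the Čech complex of `M` on `x_1, …, x_d`. -/
@[reducible] noncomputable def localCohomology (M : GrMod K W) (i : ℤ) : GrMod K W :=
  (M.cocycles i).quot
    ((LinearMap.range (M.cechD (sub_add_cancel i 1))).comap (Submodule.subtype _))
    (isHomogeneous_comap (N := M.cech i) (sub_subtype_isGr _ _ _)
      (isHomogeneous_range (M.cechD_isGr _)))

end LocalCohomology

section Ext

/-- The `A`-linear maps `M → N` of degree `g`. -/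
def homDeg (M N : GrMod K W) (g : Fin m → ℤ) :
    AddSubgroup (M.carrier →ₗ[MvPolynomial (Fin d) K] N.carrier) where
  carrier := {f | ∀ h x, x ∈ M.gr h → f x ∈ N.gr (h + g)}
  zero_mem' := fun _ _ _ => zero_mem _
  add_mem' := fun h1 h2 h x hx => add_mem (h1 h x hx) (h2 h x hx)
  neg_mem' := fun h1 h x hx => neg_mem (h1 h x hx)

theorem smul_mem_homDeg {M N : GrMod K W} {g h : Fin m → ℤ} {p : MvPolynomial (Fin d) K}
    {f : M.carrier →ₗ[MvPolynomial (Fin d) K] N.carrier}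
    (hp : p ∈ polyGr K W g) (hf : f ∈ homDeg M N h) : p • f ∈ homDeg M N (g + h) := by
  intro k x hx
  have := N.smul_mem hp (hf k x hx)
  rwa [add_left_comm] at this

/-- The submodule of `Hom_A(M, N)` of sums of homogeneous homomorphisms. -/
def homSubmodule (M N : GrMod K W) :
    Submodule (MvPolynomial (Fin d) K) (M.carrier →ₗ[MvPolynomial (Fin d) K] N.carrier) where
  carrier := (⨆ g, homDeg M N g : AddSubgroup _)
  zero_mem' := (⨆ g, homDeg M N g : AddSubgroup _).zero_mem
  add_mem' := (⨆ g, homDeg M N g : AddSubgroup _).add_mem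
  smul_mem' := fun p _ hf =>
    smul_mem_iSup (W := W) (gr := homDeg M N) (fun hp hx => smul_mem_homDeg hp hx) p hf

/-- The internal Hom of graded modules, `*Hom_A(M, N) = ⨁_g Hom_A(M, N)_g`. -/
@[reducible] noncomputable def gHom (M N : GrMod K W) : GrMod K W where
  carrier := homSubmodule M N
  gr g := (homDeg M N g).comap (homSubmodule M N).subtype.toAddMonoidHom
  isInternal := by
    apply isInternal_of
    · intro s v hv h0 g hg
      apply Subtype.ext
      have h0' : ∑ g ∈ s, (v g).1 = 0 := by simpa using congrArg Subtype.val h0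
      have key : ∀ x, x ∈ ⨆ h, M.gr h → (v g).1 x = 0 := by
        intro x hx
        induction hx using AddSubgroup.iSup_induction' with
        | h1 => simp
        | hadd x y _ _ h1 h2 => rw [map_add, h1, h2, add_zero]
        | hp i x hx =>
          refine ind_add N i s (fun g => (v g).1 x) (fun g _ => ?_) ?_ g hg
          · rw [add_comm]
            exact hv g i x hx
          · rw [← LinearMap.sum_apply, h0', LinearMap.zero_apply]
      exact LinearMap.ext fun x => key x (mem_iSup_of_isInternal M.isInternal x)
    · rintro ⟨f, hf⟩
      have hf' : f ∈ ⨆ g, homDeg M N g := hf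
      suffices h : ∃ h : f ∈ homSubmodule M N, (⟨f, h⟩ : homSubmodule M N) ∈
          ⨆ g, (homDeg M N g).comap (homSubmodule M N).subtype.toAddMonoidHom from h.2
      clear hf
      induction hf' using AddSubgroup.iSup_induction' with
      | h1 => exact ⟨zero_mem _, zero_mem _⟩
      | hadd x y _ _ h1 h2 => exact ⟨add_mem h1.1 h2.1, add_mem h1.2 h2.2⟩
      | hp i x hx =>
        exact ⟨AddSubgroup.mem_iSup_of_mem i hx, AddSubgroup.mem_iSup_of_mem i hx⟩
  smul_mem := fun hp hx => smul_mem_homDeg hp hx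

/-- Restriction of homomorphisms along a degree-preserving map `φ : M → M'`. -/
noncomputable def gHomPrecomp {M M' : GrMod K W}
    (φ : M.carrier →ₗ[MvPolynomial (Fin d) K] M'.carrier) (hφ : IsGr φ) (N : GrMod K W) :
    (gHom M' N).carrier →ₗ[MvPolynomial (Fin d) K] (gHom M N).carrier :=
  LinearMap.restrict (LinearMap.lcomp (MvPolynomial (Fin d) K) N.carrier φ)
    (p := homSubmodule M' N) (q := homSubmodule M N) (by
      intro f hf
      have hf' : f ∈ ⨆ g, homDeg M' N g := hf
      induction hf' using AddSubgroup.iSup_induction' with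
      | h1 => rw [map_zero]; exact zero_mem _
      | hadd x y hx hy h1 h2 => rw [map_add]; exact add_mem (h1 hx) (h2 hy)
      | hp i f hfi =>
        have hfi' : LinearMap.lcomp (MvPolynomial (Fin d) K) N.carrier φ f ∈ homDeg M N i :=
          fun h x hx => hfi h _ (hφ h x hx)
        exact AddSubgroup.mem_iSup_of_mem i hfi')

theorem gHomPrecomp_isGr {M M' : GrMod K W}
    (φ : M.carrier →ₗ[MvPolynomial (Fin d) K] M'.carrier) (hφ : IsGr φ) (N : GrMod K W) :
    IsGr (gHomPrecomp φ hφ N) :=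
  fun _ _ hf h x hx => hf h _ (hφ h x hx)

/-- The graded free module with one generator of degree `g` for every element of `M_g`. -/
@[reducible] noncomputable def free (M : GrMod K W) : GrMod K W where
  carrier := (Σ g, M.gr g) →₀ MvPolynomial (Fin d) K
  gr g :=
    { carrier := {f | ∀ i, f i ∈ polyGr K W (g - i.1)}
      zero_mem' := fun _ => zero_mem _
      add_mem' := fun h1 h2 i => add_mem (h1 i) (h2 i)
      neg_mem' := fun h1 i => by
        rw [Finsupp.neg_apply]
        exact neg_mem (h1 i) }
  isInternal := by
    classical
    apply isInternal_of
    · intro s v hv h0 g hg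
      ext1 i
      refine ind_add (poly K W) (-i.1) s (fun g => v g i) (fun g _ => ?_) ?_ g hg
      · rw [← sub_eq_add_neg]
        exact hv g i
      · rw [← Finsupp.finsetSum_apply, h0, Finsupp.zero_apply]
    · intro f
      induction f using Finsupp.induction_linear with
      | zero => exact zero_mem _
      | add f g h1 h2 => exact add_mem h1 h2
      | single i p =>
        have hp := mem_iSup_of_isInternal (polyGr_isInternal K W) p
        induction hp using AddSubgroup.iSup_induction' with
        | h1 => rw [Finsupp.single_zero]; exact zero_mem _
        | hadd a b _ _ h1 h2 => rw [Finsupp.single_add]; exact add_mem h1 h2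
        | hp j p hp =>
          refine AddSubgroup.mem_iSup_of_mem (j + i.1) fun k => ?_
          by_cases h : i = k
          · subst h
            rw [Finsupp.single_eq_same, add_sub_cancel_right]
            exact hp
          · rw [Finsupp.single_eq_of_ne (Ne.symm h)]
            exact zero_mem _
  smul_mem := by
    intro g h p f hp hf i
    have := IsWeightedHomogeneous.mul hp (hf i)
    rwa [← add_sub_assoc] at this

/-- The canonical surjection from the graded free module onto `M`. -/
noncomputable def freeπ (M : GrMod K W) :
    M.free.carrier →ₗ[MvPolynomial (Fin d) K] M.carrier :=
  Finsupp.linearCombination (MvPolynomial (Fin d) K) fun i : (Σ g, M.gr g) => (i.2 : M.carrier)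

theorem freeLift_isGr {M N : GrMod K W} (y : (Σ g, M.gr g) → N.carrier)
    (hy : ∀ i, y i ∈ N.gr i.1) :
    IsGr (M := M.free) (N := N) (Finsupp.linearCombination (MvPolynomial (Fin d) K) y) := by
  intro g f hf
  rw [Finsupp.linearCombination_apply, Finsupp.sum]
  refine AddSubgroup.sum_mem _ fun i _ => ?_
  have := N.smul_mem (hf i) (hy i)
  rwa [sub_add_cancel] at this

theorem freeπ_isGr (M : GrMod K W) : IsGr M.freeπ := freeLift_isGr _ fun i => i.2.2

/-- The first syzygy module: the kernel of the canonical surjection. -/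
@[reducible] noncomputable def syz (M : GrMod K W) : GrMod K W :=
  M.free.sub (LinearMap.ker M.freeπ) (isHomogeneous_ker M.freeπ_isGr)

/-- The inclusion of the first syzygy module into the graded free module. -/
noncomputable def syzι (M : GrMod K W) :
    M.syz.carrier →ₗ[MvPolynomial (Fin d) K] M.free.carrier :=
  Submodule.subtype _

theorem syzι_isGr (M : GrMod K W) : IsGr M.syzι := sub_subtype_isGr _ _ _

/-- The module `*Ext¹_A(M, N)`, computed from the presentation `0 → Z → P → M → 0` of `M` by a
graded free module `P`: the cokernel of `*Hom_A(P, N) → *Hom_A(Z, N)`. -/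
@[reducible] noncomputable def gExt1 (M N : GrMod K W) : GrMod K W :=
  (gHom M.syz N).quot (LinearMap.range (gHomPrecomp M.syzι M.syzι_isGr N))
    (isHomogeneous_range (gHomPrecomp_isGr _ _ _))

/-- `0 → N → E → M → 0` is a short exact sequence of graded modules. -/
structure IsShortExact {N E M : GrMod K W}
    (β : N.carrier →ₗ[MvPolynomial (Fin d) K] E.carrier)
    (γ : E.carrier →ₗ[MvPolynomial (Fin d) K] M.carrier) : Prop where
  gr_left : IsGr β
  gr_right : IsGr γ
  injective : Function.Injective β
  exact : Function.Exact β γ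
  surjective : Function.Surjective γ

/-- `ξ ∈ *Ext¹_A(M, N)` is the class of `0 → N → E → M → 0`: some degree-preserving lift
`σ : P → E` of `P → M` restricts on `Z` to a homomorphism `φ : Z → N` that represents `ξ`. -/
def IsExtClass {N E M : GrMod K W}
    (β : N.carrier →ₗ[MvPolynomial (Fin d) K] E.carrier)
    (γ : E.carrier →ₗ[MvPolynomial (Fin d) K] M.carrier) (ξ : (gExt1 M N).carrier) : Prop :=
  ∃ (σ : M.free.carrier →ₗ[MvPolynomial (Fin d) K] E.carrier)
    (φ : (gHom M.syz N).carrier),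
    IsGr σ ∧ γ ∘ₗ σ = M.freeπ ∧ β ∘ₗ φ.1 = σ ∘ₗ M.syzι ∧ ξ = Submodule.Quotient.mk φ

theorem IsShortExact.mem_gr {N E M : GrMod K W}
    {β : N.carrier →ₗ[MvPolynomial (Fin d) K] E.carrier}
    {γ : E.carrier →ₗ[MvPolynomial (Fin d) K] M.carrier} (h : IsShortExact β γ)
    {g : Fin m → ℤ} {x : N.carrier} (hx : β x ∈ E.gr g) : x ∈ N.gr g := by
  have h1 : β (decompose N.gr x g) = β x := by
    rw [← decompose_map h.gr_left, decompose_of_mem_same _ hx]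
  rw [← h.injective h1]
  exact (decompose N.gr x g).2

/-- A degree-preserving map into `E` that `γ` kills factors through `N`. -/
theorem IsShortExact.exists_factor {N E M L : GrMod K W}
    {β : N.carrier →ₗ[MvPolynomial (Fin d) K] E.carrier}
    {γ : E.carrier →ₗ[MvPolynomial (Fin d) K] M.carrier} (h : IsShortExact β γ)
    (τ : L.carrier →ₗ[MvPolynomial (Fin d) K] E.carrier) (hτ : IsGr τ) (h0 : ∀ x, γ (τ x) = 0) :
    ∃ φ : (gHom L N).carrier, β ∘ₗ φ.1 = τ := by
  choose f hf using fun x => (h.exact (τ x)).1 (h0 x)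
  let φ : L.carrier →ₗ[MvPolynomial (Fin d) K] N.carrier :=
    { toFun := f
      map_add' := fun x y => h.injective (by simp [hf])
      map_smul' := fun p x => h.injective (by simp [hf]) }
  have hφ : φ ∈ homDeg L N 0 := by
    intro g x hx
    rw [add_zero]
    apply h.mem_gr
    change β (f x) ∈ _
    rw [hf]
    exact hτ g x hx
  exact ⟨⟨φ, AddSubgroup.mem_iSup_of_mem 0 hφ⟩, LinearMap.ext hf⟩

theorem IsShortExact.existsUnique_extClass {N E M : GrMod K W}
    {β : N.carrier →ₗ[MvPolynomial (Fin d) K] E.carrier}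
    {γ : E.carrier →ₗ[MvPolynomial (Fin d) K] M.carrier} (h : IsShortExact β γ) :
    ∃! ξ, IsExtClass β γ ξ := by
  have hy : ∀ i : (Σ g, M.gr g), ∃ y ∈ E.gr i.1, γ y = i.2 := by
    rintro ⟨g, x, hx⟩
    obtain ⟨y, rfl⟩ := h.surjective x
    refine ⟨decompose E.gr y g, (decompose E.gr y g).2, ?_⟩
    rw [← decompose_map h.gr_right, decompose_of_mem_same _ hx]
  choose y hy hγ using hy
  let σ : M.free.carrier →ₗ[MvPolynomial (Fin d) K] E.carrier :=
    Finsupp.linearCombination (MvPolynomial (Fin d) K) y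
  have hσ : IsGr σ := freeLift_isGr y hy
  have hγσ : γ ∘ₗ σ = M.freeπ := by
    apply Finsupp.lhom_ext
    intro i p
    simp [σ, freeπ, hγ]
  obtain ⟨φ, hφ⟩ := h.exists_factor (L := M.syz) (σ ∘ₗ M.syzι)
    (fun g x hx => hσ g _ (M.syzι_isGr g x hx)) (fun x => by
      have : M.freeπ (M.syzι x) = 0 := x.2
      exact (LinearMap.congr_fun hγσ (M.syzι x)).trans this)
  refine ⟨Submodule.Quotient.mk φ, ⟨σ, φ, hσ, hγσ, hφ, rfl⟩, ?_⟩
  rintro _ ⟨σ', φ', hσ', hγσ', hφ', rfl⟩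
  obtain ⟨τ, hτ⟩ := h.exists_factor (L := M.free) (σ' - σ)
    (fun g x hx => sub_mem (hσ' g x hx) (hσ g x hx)) (fun x => by
      have h1 := LinearMap.congr_fun hγσ x
      have h2 := LinearMap.congr_fun hγσ' x
      simp only [LinearMap.comp_apply] at h1 h2
      rw [LinearMap.sub_apply, map_sub, h1, h2, sub_self])
  refine (Submodule.Quotient.eq _).2 ⟨τ, ?_⟩
  apply Subtype.ext
  apply LinearMap.ext
  intro x
  apply h.injective
  have h1 := LinearMap.congr_fun hφ x
  have h2 := LinearMap.congr_fun hφ' x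
  have h3 := LinearMap.congr_fun hτ (M.syzι x)
  simp only [LinearMap.comp_apply, LinearMap.sub_apply] at h1 h2 h3
  change β (τ.1 (M.syzι x)) = β (φ'.1 x - φ.1 x)
  rw [map_sub, h1, h2, h3]

/-- The class in `*Ext¹_A(M, N)` of a short exact sequence `0 → N → E → M → 0`. -/
noncomputable def extClass {N E M : GrMod K W}
    {β : N.carrier →ₗ[MvPolynomial (Fin d) K] E.carrier}
    {γ : E.carrier →ₗ[MvPolynomial (Fin d) K] M.carrier} (h : IsShortExact β γ) :
    (gExt1 M N).carrier :=
  h.existsUnique_extClass.choose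

end Ext

section Face

/-- The face ideal `F_t = (x_1, …, x_t)`. -/
noncomputable def faceIdeal (K : Type u) [Field K] (d t : ℕ) : Ideal (MvPolynomial (Fin d) K) :=
  Ideal.span {p | ∃ j : Fin d, j.val < t ∧ p = X j}

/-- The graded module `A / F_t`. -/
@[reducible] noncomputable def faceRing (K : Type u) [Field K] {m d : ℕ} (W : Matrix (Fin m) (Fin d) ℤ)
    (t : ℕ) : GrMod K W :=
  (poly K W).quot (faceIdeal K d t) (isHomogeneous_span (poly K W) _ (by
    rintro _ ⟨j, _, rfl⟩
    exact ⟨wt W j, isWeightedHomogeneous_X K (wt W) j⟩))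

/-- The graded module `Q_t = H^{d-t}_𝔪(A / F_t)`. -/
@[reducible] noncomputable def Q (K : Type u) [Field K] {m d : ℕ} (W : Matrix (Fin m) (Fin d) ℤ)
    (t : ℕ) : GrMod K W :=
  (faceRing K W t).localCohomology ((d : ℤ) - (t : ℤ))

end Face

end GrMod

end GradedLC

/-! Indices start at 0, so `X ⟨t, ht⟩` is the variable x_{t+1}; call it x, and let c be its degree.
Put E = Q_t, M = E(c) and N = Q_{t+1}(c).

The first ingredient is graded Matlis duality. Q_t has a K-basis of inverse monomials in the
variables outside F_t, so it is a twist of the graded K-dual of A/F_t. All that is needed of this is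
recorded in `SocleFunctional`: a residue functional ε for which the numbers ε(x^n y) are coordinates
of y, almost all zero because positive type makes the graded pieces of A finite-dimensional.
`nonempty_socleFunctional_Q` constructs it from the Čech complex. Coordinates show that x is
surjective on E with kernel N (`exists_isShortExact`), that homogeneous endomorphisms of N are
multiplications by polynomials (`exists_eq_smul_of_mem_homDeg`), and that N is injective relative to
A/F_{t+1} (`exists_extension`).

The second ingredient computes Ext from 0 → Z → P → M → 0 with P graded free. A cocycle φ : Z → N
yields an endomorphism of N: for y in N, lift βy to q in P and take φ(xq). Since x kills N, this
does not depend on q (`exists_induced_endomorphism`). Coboundaries give 0 and the class of the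
sequence gives the identity (`cocycle_X_smul`). In effect this is Ext¹(M, N) → Hom(Tor₁(M, A/x), N)
= End(N), and End(N) = A/F_{t+1} by duality.

It remains to see that this map is injective. If the induced endomorphism is 0, then φ vanishes on
all of Z ∩ F_{t+1}P (`apply_eq_zero_of_mem_faceIdeal_smul`; surjectivity of x on E enters here), so
φ comes from a submodule of P/F_{t+1}P and extends to P by relative injectivity. Hence every class
is a multiple of the extension class, with annihilator exactly F_{t+1}. -/

namespace GradedLC

namespace GrMod

variable {K : Type u} [Field K] {m d : ℕ} {W : Matrix (Fin m) (Fin d) ℤ}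

/-! ### Consequences of positive type, and degree bookkeeping -/

section Grading

/-- Only finitely many monomials have a given degree when `W` is of positive type. -/
theorem finite_setOf_weight_eq (hW : IsPositiveType W) (g : Fin m → ℤ) :
    {n : Fin d →₀ ℕ | Finsupp.weight (wt W) n = g}.Finite := by
  obtain ⟨-, a, ha⟩ := hW
  -- Pairing degrees with a gives every variable a positive integer weight, so each exponent of a
  -- monomial of degree g is at most Σ a_i g_i.
  refine (Set.finite_Iic
    (Finsupp.equivFunOnFinite.symm fun _ : Fin d => (∑ i, a i * g i).toNat)).subset ?_
  intro n hn
  change Finsupp.weight (wt W) n = g at hn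
  intro j
  have h1 : ∑ i, a i * g i = ∑ j, (n j : ℤ) * ∑ i, a i * W i j := by
    rw [← hn, Finsupp.weight_apply, Finsupp.sum_fintype _ _ (by simp)]
    simp only [Finset.sum_apply, Finset.mul_sum]
    rw [Finset.sum_comm]
    refine Finset.sum_congr rfl fun j _ => Finset.sum_congr rfl fun i _ => ?_
    rw [Pi.smul_apply, nsmul_eq_mul, wt]
    ring
  have h2 : (n j : ℤ) * ∑ i, a i * W i j ≤ ∑ i, a i * g i := by
    rw [h1]
    exact Finset.single_le_sum (f := fun j => (n j : ℤ) * ∑ i, a i * W i j)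
      (fun k _ => mul_nonneg (by positivity) (ha k).le) (Finset.mem_univ j)
  have h3 : (n j : ℤ) ≤ (n j : ℤ) * ∑ i, a i * W i j :=
    le_mul_of_one_le_right (by positivity) (ha j)
  change n j ≤ (∑ i, a i * g i).toNat
  omega

theorem monomial_mem (n : Fin d →₀ ℕ) (a : K) :
    monomial n a ∈ polyGr K W (Finsupp.weight (wt W) n) :=
  isWeightedHomogeneous_monomial _ _ _ rfl

theorem C_mem (a : K) : (C a : MvPolynomial (Fin d) K) ∈ polyGr K W 0 :=
  isWeightedHomogeneous_C _ _

theorem X_mem (j : Fin d) : (X j : MvPolynomial (Fin d) K) ∈ polyGr K W (wt W j) :=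
  isWeightedHomogeneous_X K (wt W) j

theorem gr_induction (M : GrMod K W) {p : M.carrier → Prop} (x : M.carrier)
    (h0 : p 0) (hadd : ∀ x y, p x → p y → p (x + y)) (hgr : ∀ g, ∀ x ∈ M.gr g, p x) : p x := by
  have hx := mem_iSup_of_isInternal M.isInternal x
  induction hx using AddSubgroup.iSup_induction' with
  | hp i x hx => exact hgr i x hx
  | h1 => exact h0
  | hadd x y _ _ h1 h2 => exact hadd x y h1 h2

theorem decompose_smul_of_mem (M : GrMod K W) {p : MvPolynomial (Fin d) K} {g : Fin m → ℤ}
    (hp : p ∈ polyGr K W g) (x : M.carrier) (h : Fin m → ℤ) :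
    (decompose M.gr (p • x) (g + h) : M.carrier) = p • (decompose M.gr x h : M.carrier) := by
  induction x using DirectSum.Decomposition.inductionOn M.gr with
  | zero => simp
  | @homogeneous i x =>
    by_cases hi : i = h
    · subst hi
      rw [decompose_of_mem_same _ x.2, decompose_of_mem_same _ (M.smul_mem hp x.2)]
    · rw [decompose_of_mem_ne _ x.2 hi,
        decompose_of_mem_ne _ (M.smul_mem hp x.2) (by simpa using hi), smul_zero]
  | add a b ha hb => simp [decompose_add, ha, hb]

/-- The degree-g component of x has the same image as x, so injectivity identifies the two. This
makes a bijective graded map an `Iso`. -/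
theorem mem_gr_of_injective {M N : GrMod K W}
    {f : M.carrier →ₗ[MvPolynomial (Fin d) K] N.carrier} (hf : IsGr f)
    (hinj : Function.Injective f) {g : Fin m → ℤ} {x : M.carrier} (hx : f x ∈ N.gr g) :
    x ∈ M.gr g := by
  have h1 : f (decompose M.gr x g) = f x := by
    rw [← decompose_map hf, decompose_of_mem_same _ hx]
  rw [← hinj h1]
  exact (decompose M.gr x g).2

/-- A bijective degree-preserving map is an isomorphism of graded modules. -/
noncomputable def Iso.ofBijective {M N : GrMod K W}
    (f : M.carrier →ₗ[MvPolynomial (Fin d) K] N.carrier) (hf : IsGr f)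
    (hbij : Function.Bijective f) : Iso M N where
  toEquiv := LinearEquiv.ofBijective f hbij
  mem_iff g x := ⟨fun h => mem_gr_of_injective hf hbij.1 h, fun h => hf g x h⟩

end Grading

/-! ### The monomial ideals F_t -/

section Face

theorem monomial_eq_X_mul {n : Fin d →₀ ℕ} {j : Fin d} (hn : n j ≠ 0) :
    (monomial n 1 : MvPolynomial (Fin d) K) = X j * monomial (n - Finsupp.single j 1) 1 := by
  rw [X, monomial_mul, one_mul, add_tsub_cancel_of_le]
  simpa [Nat.one_le_iff_ne_zero] using hn

theorem mem_faceIdeal_iff {t : ℕ} {p : MvPolynomial (Fin d) K} :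
    p ∈ faceIdeal K d t ↔ ∀ n : Fin d →₀ ℕ, (∀ j, j.val < t → n j = 0) → coeff n p = 0 := by
  have h : {p : MvPolynomial (Fin d) K | ∃ j : Fin d, j.val < t ∧ p = X j} =
      X '' {j : Fin d | j.val < t} := by
    ext p
    simp [eq_comm]
  rw [faceIdeal, h, mem_ideal_span_X_image]
  constructor
  · intro hp n hn
    by_contra hc
    obtain ⟨j, hj, hj'⟩ := hp n (mem_support_iff.2 hc)
    exact hj' (hn j hj)
  · intro hp n hn
    by_contra! hc
    exact mem_support_iff.1 hn (hp n hc)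

theorem X_mem_faceIdeal {t : ℕ} {j : Fin d} (hj : j.val < t) :
    (X j : MvPolynomial (Fin d) K) ∈ faceIdeal K d t :=
  Ideal.subset_span ⟨j, hj, rfl⟩

theorem faceIdeal_smul_eq_zero {Y : Type*} [AddCommGroup Y] [Module (MvPolynomial (Fin d) K) Y]
    {t : ℕ} (hY : ∀ j : Fin d, j.val < t → ∀ y : Y, (X j : MvPolynomial (Fin d) K) • y = 0)
    {p : MvPolynomial (Fin d) K} (hp : p ∈ faceIdeal K d t) (y : Y) : p • y = 0 := by
  have : faceIdeal K d t ≤ LinearMap.ker (LinearMap.toSpanSingleton (MvPolynomial (Fin d) K) Y y) := by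
    refine Ideal.span_le.2 ?_
    rintro _ ⟨j, hj, rfl⟩
    exact hY j hj y
  exact this hp

theorem isHomogeneous_faceIdeal_smul (M : GrMod K W) (t : ℕ) :
    (faceIdeal K d t • (⊤ : Submodule (MvPolynomial (Fin d) K) M.carrier)).IsHomogeneous M.gr := by
  intro g x hx
  induction hx using Submodule.smul_induction_on' with
  | smul p hp x _ =>
    induction hp using Submodule.span_induction generalizing x with
    | zero => simp
    | add p q _ _ h1 h2 =>
      rw [add_smul, decompose_add]
      exact add_mem (h1 x trivial) (h2 x trivial)
    | smul a p _ h => rw [smul_eq_mul, mul_comm, mul_smul]; exact h (a • x) trivial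
    | mem p hp =>
      obtain ⟨j, hj, rfl⟩ := hp
      have := decompose_smul_of_mem M (X_mem (K := K) (W := W) j) x (g - wt W j)
      rw [add_sub_cancel] at this
      rw [this]
      exact Submodule.smul_mem_smul (X_mem_faceIdeal hj) trivial
  | add x _ y _ h1 h2 =>
    rw [decompose_add]
    exact add_mem h1 h2

/-- This is F_{t+1} = F_t + (x_{t+1}), applied to a module; the multiples of x_{t+1} collect into a
single one. -/
theorem exists_eq_smul_add_of_mem_faceIdeal_smul {Y : Type*} [AddCommGroup Y]
    [Module (MvPolynomial (Fin d) K) Y] {t : ℕ} (ht : t < d) {y : Y}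
    (hy : y ∈ faceIdeal K d (t + 1) • (⊤ : Submodule (MvPolynomial (Fin d) K) Y)) :
    ∃ q : Y, ∃ w ∈ faceIdeal K d t • (⊤ : Submodule (MvPolynomial (Fin d) K) Y),
      y = (X ⟨t, ht⟩ : MvPolynomial (Fin d) K) • q + w := by
  induction hy using Submodule.smul_induction_on' with
  | smul p hp x _ =>
    induction hp using Submodule.span_induction generalizing x with
    | zero => exact ⟨0, 0, zero_mem _, by simp⟩
    | add p p' _ _ h1 h2 =>
      obtain ⟨q, w, hw, h⟩ := h1 x trivial
      obtain ⟨q', w', hw', h'⟩ := h2 x trivial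
      exact ⟨q + q', w + w', add_mem hw hw', by rw [add_smul, h, h', smul_add]; abel⟩
    | smul a p _ h => rw [smul_eq_mul, mul_comm, mul_smul]; exact h (a • x) trivial
    | mem p hp =>
      obtain ⟨j, hj, rfl⟩ := hp
      rcases Nat.lt_succ_iff_lt_or_eq.1 hj with hj | hj
      · exact ⟨0, _, Submodule.smul_mem_smul (X_mem_faceIdeal hj) (Submodule.mem_top (x := x)),
          by simp⟩
      · obtain rfl : j = ⟨t, ht⟩ := Fin.ext hj
        exact ⟨x, 0, zero_mem _, by simp⟩
  | add x _ y _ h1 h2 =>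
    obtain ⟨q, w, hw, h⟩ := h1
    obtain ⟨q', w', hw', h'⟩ := h2
    exact ⟨q + q', w + w', add_mem hw hw', by rw [h, h', smul_add]; abel⟩

end Face

/-! ### Graded duals of A/F_t through their functionals -/

section SocleFunctional

/-- A graded functional that exhibits `N` as a twist of the graded dual of `A / F_t`: it is
supported in degree `s`, it detects the elements of `N`, and the monomials outside `F_t` have a
dual basis. -/
structure SocleFunctional (N : GrMod K W) (t : ℕ) (s : Fin m → ℤ) where
  toFun : N.carrier →+ K
  map_C_smul : ∀ (a : K) x, toFun ((C a : MvPolynomial (Fin d) K) • x) = a * toFun x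
  eq_of_ne_zero : ∀ {h x}, x ∈ N.gr h → toFun x ≠ 0 → h = s
  eq_zero : ∀ x, (∀ n, toFun ((monomial n 1 : MvPolynomial (Fin d) K) • x) = 0) → x = 0
  X_smul : ∀ j : Fin d, j.val < t → ∀ x : N.carrier, (X j : MvPolynomial (Fin d) K) • x = 0
  exists_dual : ∀ n : Fin d →₀ ℕ, (∀ j : Fin d, j.val < t → n j = 0) → ∃ z : N.carrier,
    ∀ n', toFun ((monomial n' 1 : MvPolynomial (Fin d) K) • z) = if n' = n then 1 else 0

namespace SocleFunctional

variable {N : GrMod K W} {t : ℕ} {s : Fin m → ℤ}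

theorem faceIdeal_smul (ε : SocleFunctional N t s) {p : MvPolynomial (Fin d) K}
    (hp : p ∈ faceIdeal K d t) (x : N.carrier) : p • x = 0 :=
  faceIdeal_smul_eq_zero ε.X_smul hp x

theorem ext (ε : SocleFunctional N t s) {x y : N.carrier}
    (h : ∀ n, ε.toFun ((monomial n 1 : MvPolynomial (Fin d) K) • x) =
      ε.toFun ((monomial n 1 : MvPolynomial (Fin d) K) • y)) : x = y := by
  rw [← sub_eq_zero]
  refine ε.eq_zero _ fun n => ?_
  rw [smul_sub, map_sub, h, sub_self]

theorem monomial_smul_eq_zero (ε : SocleFunctional N t s) {n : Fin d →₀ ℕ} {j : Fin d}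
    (hj : j.val < t) (hn : n j ≠ 0) (x : N.carrier) :
    (monomial n 1 : MvPolynomial (Fin d) K) • x = 0 := by
  refine ε.faceIdeal_smul (mem_faceIdeal_iff.2 fun k hk => ?_) x
  rw [coeff_monomial, if_neg]
  rintro rfl
  exact hn (hk j hj)

/-- The functional on the twist `N(c)`. -/
def shift (ε : SocleFunctional N t s) (c : Fin m → ℤ) : SocleFunctional (N.shift c) t (s - c) where
  toFun := ε.toFun
  map_C_smul := ε.map_C_smul
  eq_of_ne_zero := fun hx h0 => eq_sub_of_add_eq (ε.eq_of_ne_zero hx h0)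
  eq_zero := ε.eq_zero
  X_smul := ε.X_smul
  exists_dual := ε.exists_dual

/-- Degrees can be read off coordinates. For a fixed n only the component of x of degree s - deg x^n
contributes to ε(x^n x), so a nonzero component in degree g ≠ h would produce a nonzero coordinate
in a forbidden place. -/
theorem mem_gr (ε : SocleFunctional N t s) {h : Fin m → ℤ} {x : N.carrier}
    (hx : ∀ n, ε.toFun ((monomial n 1 : MvPolynomial (Fin d) K) • x) ≠ 0 →
      Finsupp.weight (wt W) n + h = s) : x ∈ N.gr h := by
  classical
  have key : ∀ g, g ≠ h → (decompose N.gr x g : N.carrier) = 0 := by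
    intro g hg
    refine ε.eq_zero _ fun n => ?_
    by_contra hn
    have hs := ε.eq_of_ne_zero (N.smul_mem (monomial_mem n 1) (decompose N.gr x g).2) hn
    apply hg
    apply add_left_cancel (a := Finsupp.weight (wt W) n)
    rw [hs]
    refine (hx n ?_).symm
    have h1 : ε.toFun ((monomial n 1 : MvPolynomial (Fin d) K) • x) =
        ε.toFun ((monomial n 1 : MvPolynomial (Fin d) K) • (decompose N.gr x g : N.carrier)) := by
      conv_lhs => rw [← DirectSum.sum_support_decompose N.gr x]
      rw [Finset.smul_sum, map_sum]
      refine Finset.sum_eq_single g (fun k _ hk => ?_) (fun hg' => ?_)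
      · by_contra hk'
        have := ε.eq_of_ne_zero (N.smul_mem (monomial_mem n 1) (decompose N.gr x k).2) hk'
        exact hk (add_left_cancel (this.trans hs.symm))
      · rw [DFinsupp.notMem_support_iff.1 hg']
        simp
    rwa [h1]
  rw [← DirectSum.sum_support_decompose N.gr x]
  refine AddSubgroup.sum_mem _ fun g _ => ?_
  by_cases hg : g = h
  · subst hg
    exact (decompose N.gr x g).2
  · rw [key g hg]
    exact zero_mem _

/-- A functional supported in one degree is nonzero on finitely many monomial multiples of a given
element. -/
theorem finite_setOf_ne_zero (hW : IsPositiveType W) {L : GrMod K W} (l : L.carrier →+ K)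
    {r : Fin m → ℤ} (hl : ∀ {h x}, x ∈ L.gr h → l x ≠ 0 → h = r) (x : L.carrier) :
    {n : Fin d →₀ ℕ | l ((monomial n 1 : MvPolynomial (Fin d) K) • x) ≠ 0}.Finite := by
  induction x using gr_induction with
  | h0 => simp
  | hadd x y h1 h2 =>
    refine (h1.union h2).subset fun n hn => ?_
    by_contra hc
    rw [Set.mem_union, not_or] at hc
    have h1 := not_not.1 hc.1
    have h2 := not_not.1 hc.2
    exact hn (by rw [smul_add, map_add, h1, h2, add_zero])
  | hgr g x hx =>
    refine (finite_setOf_weight_eq hW (r - g)).subset fun n hn => ?_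
    exact eq_sub_of_add_eq (hl (L.smul_mem (monomial_mem n 1) hx) hn)

/-- Every finitely supported family of coordinates on the monomials outside F_t occurs: take the
corresponding combination of the dual basis. -/
theorem exists_eq (ε : SocleFunctional N t s) (a : (Fin d →₀ ℕ) → K) (hfin : {n | a n ≠ 0}.Finite)
    (ha : ∀ n (j : Fin d), j.val < t → n j ≠ 0 → a n = 0) :
    ∃ y : N.carrier, ∀ n, ε.toFun ((monomial n 1 : MvPolynomial (Fin d) K) • y) = a n := by
  classical
  have hz : ∀ n : Fin d →₀ ℕ, ∃ z : N.carrier, ∀ n',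
      ε.toFun ((monomial n' 1 : MvPolynomial (Fin d) K) • z) = if n' = n then a n else 0 := by
    intro n
    by_cases hn : ∀ j : Fin d, j.val < t → n j = 0
    · obtain ⟨z, hz⟩ := ε.exists_dual n hn
      refine ⟨(C (a n) : MvPolynomial (Fin d) K) • z, fun n' => ?_⟩
      rw [smul_comm, ε.map_C_smul, hz]
      simp
    · push Not at hn
      obtain ⟨j, hj, hn⟩ := hn
      exact ⟨0, fun n' => by simp [ha n j hj hn]⟩
  choose z hz using hz
  refine ⟨∑ n ∈ hfin.toFinset, z n, fun n => ?_⟩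
  rw [Finset.smul_sum, map_sum, Finset.sum_congr rfl fun k _ => hz k n, Finset.sum_ite_eq]
  split_ifs with hn
  · rfl
  · rw [eq_comm]
    simpa using hn

/-- The universal property of a graded dual. The image of x is the element with coordinates l(x^n
x), finite in number by positive type and zero on F_t by `hX`; linearity is checked on coordinates.
-/
theorem exists_lift (hW : IsPositiveType W) (ε : SocleFunctional N t s) {L : GrMod K W}
    (l : L.carrier →+ K) {r : Fin m → ℤ}
    (hC : ∀ (a : K) x, l ((C a : MvPolynomial (Fin d) K) • x) = a * l x)
    (hl : ∀ {h x}, x ∈ L.gr h → l x ≠ 0 → h = r)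
    (hX : ∀ j : Fin d, j.val < t → ∀ x, l ((X j : MvPolynomial (Fin d) K) • x) = 0) :
    ∃ f ∈ homDeg L N (s - r), ∀ x, ε.toFun (f x) = l x := by
  classical
  choose f hf using fun x : L.carrier => ε.exists_eq
    (fun n => l ((monomial n 1 : MvPolynomial (Fin d) K) • x)) (finite_setOf_ne_zero hW l hl x)
    (fun n j hj hn => by
      rw [monomial_eq_X_mul hn, mul_smul]
      exact hX j hj _)
  have hf' : ∀ (p : MvPolynomial (Fin d) K) x, ε.toFun (p • f x) = l (p • x) := by
    intro p x
    induction p using MvPolynomial.induction_on' with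
    | monomial n a =>
      rw [← mul_one a, ← C_mul_monomial, mul_smul, mul_smul, ε.map_C_smul, hC, hf]
    | add p q hp hq => rw [add_smul, add_smul, map_add, map_add, hp, hq]
  let F : L.carrier →ₗ[MvPolynomial (Fin d) K] N.carrier :=
    { toFun := f
      map_add' := fun x y => ε.ext fun n => by
        rw [smul_add, map_add, hf, hf, hf, smul_add, map_add]
      map_smul' := fun p x => ε.ext fun n => by
        rw [hf, RingHom.id_apply, ← mul_smul, ← mul_smul, hf'] }
  -- A nonzero coordinate l(x^n x) forces deg x^n + h = r, and hence deg x^n + h + (s - r) = s.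
  refine ⟨F, fun h x hx => ε.mem_gr fun n hn => ?_, fun x => ?_⟩
  · change ε.toFun (_ • f x) ≠ 0 at hn
    rw [hf] at hn
    rw [← add_assoc, hl (L.smul_mem (monomial_mem n 1) hx) hn]
    abel
  · have := hf' 1 x
    rwa [one_smul, one_smul] at this

/-- The dual elements span N, since both sides have the same coordinates. A map out of N is
therefore known from its values on them. -/
theorem sum_dual (hW : IsPositiveType W) (ε : SocleFunctional N t s) (y : N.carrier)
    {z : (Fin d →₀ ℕ) → N.carrier}
    (hz : ∀ n, (∀ j : Fin d, j.val < t → n j = 0) → ∀ n',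
      ε.toFun ((monomial n' 1 : MvPolynomial (Fin d) K) • z n) = if n' = n then 1 else 0) :
    y = ∑ n ∈ (finite_setOf_ne_zero hW ε.toFun ε.eq_of_ne_zero y).toFinset,
      (C (ε.toFun ((monomial n 1 : MvPolynomial (Fin d) K) • y)) : MvPolynomial (Fin d) K) • z n := by
  classical
  refine ε.ext fun n => ?_
  rw [Finset.smul_sum, map_sum, Finset.sum_congr rfl (g := fun k =>
    if n = k then ε.toFun ((monomial k 1 : MvPolynomial (Fin d) K) • y) else 0), Finset.sum_ite_eq]
  · split_ifs with hn
    · rfl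
    · simpa using hn
  · intro k hk
    have hk' : ε.toFun ((monomial k 1 : MvPolynomial (Fin d) K) • y) ≠ 0 := by simpa using hk
    rw [smul_comm, ε.map_C_smul, hz k fun j hj => by
      by_contra hc
      exact hk' (by rw [ε.monomial_smul_eq_zero hj hc, map_zero])]
    simp

theorem toFun_smul_dual (ε : SocleFunctional N t s) {n : Fin d →₀ ℕ} {z : N.carrier}
    (hz : ∀ n', ε.toFun ((monomial n' 1 : MvPolynomial (Fin d) K) • z) = if n' = n then 1 else 0)
    (p : MvPolynomial (Fin d) K) : ε.toFun (p • z) = coeff n p := by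
  classical
  induction p using MvPolynomial.induction_on' with
  | monomial k a =>
    rw [← mul_one a, ← C_mul_monomial, mul_smul, ε.map_C_smul, hz, coeff_C_mul, coeff_monomial]
  | add p q hp hq => rw [add_smul, map_add, hp, hq, coeff_add]

theorem mem_faceIdeal_of_smul_eq_zero (ε : SocleFunctional N t s) {p : MvPolynomial (Fin d) K}
    (hp : ∀ y : N.carrier, p • y = 0) : p ∈ faceIdeal K d t := by
  refine mem_faceIdeal_iff.2 fun n hn => ?_
  obtain ⟨z, hz⟩ := ε.exists_dual n hn
  rw [← ε.toFun_smul_dual hz, hp, map_zero]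

/-- The homogeneous endomorphisms of a twisted graded dual of `A / F_t` are multiplications. -/
theorem exists_eq_smul_of_mem_homDeg (hW : IsPositiveType W) (ε : SocleFunctional N t s)
    {g : Fin m → ℤ} {f : N.carrier →ₗ[MvPolynomial (Fin d) K] N.carrier} (hf : f ∈ homDeg N N g) :
    ∃ p ∈ polyGr K W g, ∀ y, f y = p • y := by
  classical
  have hz : ∀ n : Fin d →₀ ℕ, ∃ z : N.carrier, (∀ j : Fin d, j.val < t → n j = 0) → ∀ n',
      ε.toFun ((monomial n' 1 : MvPolynomial (Fin d) K) • z) = if n' = n then 1 else 0 := by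
    intro n
    by_cases hn : ∀ j : Fin d, j.val < t → n j = 0
    · obtain ⟨z, hz⟩ := ε.exists_dual n hn
      exact ⟨z, fun _ => hz⟩
    · exact ⟨0, fun h => absurd h hn⟩
  choose z hz using hz
  -- Multiplication by p would give ε(p z_n) = coeff n p, so the coefficients are forced to be ε(f
  -- z_n). Only exponents of weight g matter: f z_n has degree s - deg x^n + g, and ε lives in
  -- degree s.
  let p : MvPolynomial (Fin d) K :=
    ∑ n ∈ (finite_setOf_weight_eq hW g).toFinset, monomial n (ε.toFun (f (z n)))
  have hp : p ∈ polyGr K W g := Submodule.sum_mem _ fun n hn => by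
    have : Finsupp.weight (wt W) n = g := by simpa using hn
    rw [← this]
    exact monomial_mem n _
  have hcoeff : ∀ n, (∀ j : Fin d, j.val < t → n j = 0) → coeff n p = ε.toFun (f (z n)) := by
    intro n hn
    rw [coeff_sum, Finset.sum_congr rfl fun k _ => coeff_monomial n k _, Finset.sum_ite_eq']
    split_ifs with hn'
    · rfl
    · by_contra hc
      have hzn : z n ∈ N.gr (s - Finsupp.weight (wt W) n) := ε.mem_gr fun n' h => by
        rw [hz n hn n'] at h
        obtain rfl : n' = n := by
          by_contra hne
          exact h (if_neg hne)
        abel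
      have := ε.eq_of_ne_zero (hf _ _ hzn) (Ne.symm hc)
      apply hn'
      have h2 : Finsupp.weight (wt W) n = g := by
        rw [sub_add_eq_add_sub, sub_eq_iff_eq_add] at this
        exact (add_left_cancel this).symm
      simpa using h2
  have hε : ∀ y, ε.toFun (f y) = ε.toFun (p • y) := by
    intro y
    rw [ε.sum_dual hW y hz, map_sum, Finset.smul_sum, map_sum, map_sum]
    refine Finset.sum_congr rfl fun n hn => ?_
    have hn' : ε.toFun ((monomial n 1 : MvPolynomial (Fin d) K) • y) ≠ 0 := by simpa using hn
    have hnt : ∀ j : Fin d, j.val < t → n j = 0 := fun j hj => by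
      by_contra hc
      exact hn' (by rw [ε.monomial_smul_eq_zero hj hc, map_zero])
    rw [map_smul, ε.map_C_smul, smul_comm, ε.map_C_smul, ε.toFun_smul_dual (hz n hnt), hcoeff n hnt]
  refine ⟨p, hp, fun y => ε.ext fun n => ?_⟩
  rw [← map_smul, hε, smul_comm]

/-- Homogeneous maps into a twisted graded dual of `A / F_t` extend. -/
theorem exists_extension (hW : IsPositiveType W) (ε : SocleFunctional N t s) {L : GrMod K W}
    (S : Submodule (MvPolynomial (Fin d) K) L.carrier) (hS : S.IsHomogeneous L.gr)
    {g : Fin m → ℤ} {φ : S →ₗ[MvPolynomial (Fin d) K] N.carrier}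
    (hφ : φ ∈ homDeg (L.sub S hS) N g)
    (h0 : ∀ z : S, (z : L.carrier) ∈
      faceIdeal K d t • (⊤ : Submodule (MvPolynomial (Fin d) K) L.carrier) → φ z = 0) :
    ∃ ψ ∈ homDeg L N g, ∀ z : S, ψ z = φ z := by
  classical
  let : Module K L.carrier := Module.compHom L.carrier (C : K →+* MvPolynomial (Fin d) K)
  have : IsScalarTower K (MvPolynomial (Fin d) K) L.carrier :=
    ⟨fun a p x => by rw [smul_eq_C_mul, mul_smul]; rfl⟩
  have hCL : ∀ (a : K) (x : L.carrier), a • x = (C a : MvPolynomial (Fin d) K) • x :=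
    fun _ _ => rfl
  set FL := faceIdeal K d t • (⊤ : Submodule (MvPolynomial (Fin d) K) L.carrier) with hFL
  -- Extending φ reduces to extending the K-linear functional ε ∘ φ. It vanishes on S ∩ F_t L, so
  -- over the field K it is the restriction of a functional μ on all of L/F_t L.
  let q : S →ₗ[K] L.carrier ⧸ FL := (FL.mkQ ∘ₗ S.subtype).restrictScalars K
  let l : S →ₗ[K] K :=
    { toFun := fun z => ε.toFun (φ z)
      map_add' := fun x y => by rw [map_add, map_add]
      map_smul' := fun a x => by
        have : a • x = (C a : MvPolynomial (Fin d) K) • x := Subtype.ext (hCL a x)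
        rw [this, map_smul, ε.map_C_smul]
        rfl }
  have hl : l ∈ (LinearMap.ker q).dualAnnihilator := by
    rw [Submodule.mem_dualAnnihilator]
    intro z hz
    have hz' : FL.mkQ (z : L.carrier) = 0 := hz
    change ε.toFun (φ z) = 0
    rw [h0 z ((Submodule.Quotient.mk_eq_zero _).1 hz'), map_zero]
  rw [← LinearMap.range_dualMap_eq_dualAnnihilator_ker] at hl
  obtain ⟨μ, hμ⟩ := hl
  have hμ' : ∀ z : S, μ (FL.mkQ z) = ε.toFun (φ z) := fun z => LinearMap.congr_fun hμ z
  have hμC : ∀ (a : K) (x : L.carrier),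
      μ (FL.mkQ ((C a : MvPolynomial (Fin d) K) • x)) = a * μ (FL.mkQ x) := by
    intro a x
    rw [← hCL]
    have : FL.mkQ (a • x) = a • FL.mkQ x := rfl
    rw [this, map_smul, smul_eq_mul]
  -- μ need not respect the grading. Precomposing with the projection to degree s - g makes it
  -- homogeneous and changes nothing on S, where ε ∘ φ is supported in that degree.
  let l' : L.carrier →+ K :=
    { toFun := fun x => μ (FL.mkQ (decompose L.gr x (s - g)))
      map_zero' := by simp
      map_add' := fun x y => by simp [decompose_add] }
  have hl' : ∀ x, l' x = μ (FL.mkQ (decompose L.gr x (s - g))) := fun _ => rfl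
  obtain ⟨ψ, hψ, hψl⟩ := ε.exists_lift hW l' (r := s - g) (fun a x => by
      have := decompose_smul_of_mem L (C_mem (K := K) (W := W) a) x (s - g)
      rw [zero_add] at this
      rw [hl', hl', this, hμC]) (fun {h x} hx hne => by
      by_contra hc
      exact hne (by rw [hl', decompose_of_mem_ne _ hx hc, map_zero, map_zero])) (fun j hj x => by
      have hx : (X j : MvPolynomial (Fin d) K) • x ∈ FL :=
        Submodule.smul_mem_smul (X_mem_faceIdeal hj) trivial
      rw [hl', Submodule.mkQ_apply, (Submodule.Quotient.mk_eq_zero _).2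
        (isHomogeneous_faceIdeal_smul L t (s - g) hx), map_zero])
  rw [sub_sub_cancel] at hψ
  refine ⟨ψ, hψ, ?_⟩
  have key : ∀ z : S, ε.toFun (ψ z) = ε.toFun (φ z) := by
    intro z
    induction z using gr_induction (M := L.sub S hS) with
    | h0 => simp
    | hadd x y h1 h2 => rw [Submodule.coe_add, map_add, map_add, map_add, map_add, h1, h2]
    | hgr h z hz =>
      have hz' : (z : L.carrier) ∈ L.gr h := hz
      rw [hψl, hl']
      by_cases hh : h = s - g
      · subst hh
        rw [decompose_of_mem_same _ hz', hμ']
      · rw [decompose_of_mem_ne _ hz' hh, map_zero, map_zero]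
        by_contra hc
        exact hh (eq_sub_of_add_eq (ε.eq_of_ne_zero (hφ h z hz) (Ne.symm hc)))
  intro z
  refine ε.ext fun n => ?_
  rw [← map_smul, ← map_smul, ← key]
  rfl

end SocleFunctional

end SocleFunctional

/-! ### Ext of the sequence given by multiplication by x_{t+1} -/

section ExtOfMultiplication

theorem isExtClass_extClass {N E M : GrMod K W}
    {β : N.carrier →ₗ[MvPolynomial (Fin d) K] E.carrier}
    {γ : E.carrier →ₗ[MvPolynomial (Fin d) K] M.carrier} (h : IsShortExact β γ) :
    IsExtClass β γ (extClass h) :=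
  h.existsUnique_extClass.choose_spec.1

theorem exists_mem_gr_freeπ_eq {M : GrMod K W} {g : Fin m → ℤ} {x : M.carrier} (hx : x ∈ M.gr g) :
    ∃ q ∈ M.free.gr g, M.freeπ q = x := by
  refine ⟨Finsupp.single ⟨g, x, hx⟩ 1, fun i => ?_, by simp [freeπ]⟩
  by_cases hi : (⟨g, x, hx⟩ : Σ g, M.gr g) = i
  · subst hi
    rw [Finsupp.single_eq_same, sub_self]
    exact isWeightedHomogeneous_one K (wt W)
  · rw [Finsupp.single_eq_of_ne (Ne.symm hi)]
    exact zero_mem _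

theorem freeπ_surjective (M : GrMod K W) : Function.Surjective M.freeπ := by
  intro x
  induction x using gr_induction with
  | h0 => exact ⟨0, map_zero _⟩
  | hadd x y h1 h2 =>
    obtain ⟨a, rfl⟩ := h1
    obtain ⟨b, rfl⟩ := h2
    exact ⟨a + b, map_add _ _ _⟩
  | hgr g x hx =>
    obtain ⟨q, -, hq⟩ := exists_mem_gr_freeπ_eq hx
    exact ⟨q, hq⟩

theorem X_smul_gExt1 {M N : GrMod K W} {j : Fin d}
    (hN : ∀ x : N.carrier, (X j : MvPolynomial (Fin d) K) • x = 0) (ξ : (gExt1 M N).carrier) :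
    (X j : MvPolynomial (Fin d) K) • ξ = 0 := by
  obtain ⟨φ, rfl⟩ := Submodule.Quotient.mk_surjective _ ξ
  rw [← Submodule.Quotient.mk_smul]
  have : (X j : MvPolynomial (Fin d) K) • φ = 0 := Subtype.ext (LinearMap.ext fun x => hN _)
  rw [this, Submodule.Quotient.mk_zero]

/-- The lift σ preserves degrees and β detects them, so the cocycle has degree 0. Hence p ↦ p •
`extClass h` preserves degrees. -/
theorem cocycle_mem_homDeg {N E M : GrMod K W}
    {β : N.carrier →ₗ[MvPolynomial (Fin d) K] E.carrier}
    {γ : E.carrier →ₗ[MvPolynomial (Fin d) K] M.carrier} (h : IsShortExact β γ)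
    {σ : M.free.carrier →ₗ[MvPolynomial (Fin d) K] E.carrier} {φ : (gHom M.syz N).carrier}
    (hσ : IsGr σ) (hφ : β ∘ₗ φ.1 = σ ∘ₗ M.syzι) : φ.1 ∈ homDeg M.syz N 0 := by
  intro g x hx
  rw [add_zero]
  apply h.mem_gr
  have := LinearMap.congr_fun hφ x
  rw [LinearMap.comp_apply] at this
  rw [this]
  exact hσ g _ (M.syzι_isGr g x hx)

theorem extClass_mem_gr {N E M : GrMod K W}
    {β : N.carrier →ₗ[MvPolynomial (Fin d) K] E.carrier}
    {γ : E.carrier →ₗ[MvPolynomial (Fin d) K] M.carrier} (h : IsShortExact β γ) :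
    extClass h ∈ (gExt1 M N).gr 0 := by
  obtain ⟨σ, φ, hσ, -, hφ, hξ⟩ := isExtClass_extClass h
  rw [hξ]
  exact ⟨φ, cocycle_mem_homDeg h hσ hφ, rfl⟩

/-- The map `A / F_t → *Ext¹_A(M, N)` given by `1 ↦ ξ`. -/
noncomputable def faceRingToExt {t : ℕ} {M N : GrMod K W}
    (hN : ∀ j : Fin d, j.val < t → ∀ x : N.carrier, (X j : MvPolynomial (Fin d) K) • x = 0)
    (ξ : (gExt1 M N).carrier) :
    (faceRing K W t).carrier →ₗ[MvPolynomial (Fin d) K] (gExt1 M N).carrier :=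
  Submodule.liftQ (faceIdeal K d t) (LinearMap.toSpanSingleton (MvPolynomial (Fin d) K) _ ξ)
    fun _ hp => faceIdeal_smul_eq_zero (fun j hj => X_smul_gExt1 (hN j hj)) hp ξ

theorem faceRingToExt_mk {t : ℕ} {M N : GrMod K W}
    (hN : ∀ j : Fin d, j.val < t → ∀ x : N.carrier, (X j : MvPolynomial (Fin d) K) • x = 0)
    (ξ : (gExt1 M N).carrier) (p : MvPolynomial (Fin d) K) :
    faceRingToExt hN ξ (Submodule.Quotient.mk p) = p • ξ :=
  rfl

theorem faceRingToExt_isGr {t : ℕ} {M N : GrMod K W}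
    (hN : ∀ j : Fin d, j.val < t → ∀ x : N.carrier, (X j : MvPolynomial (Fin d) K) • x = 0)
    {ξ : (gExt1 M N).carrier} (hξ : ξ ∈ (gExt1 M N).gr 0) : IsGr (faceRingToExt hN ξ) := by
  rintro g _ ⟨p, hp, rfl⟩
  have := (gExt1 M N).smul_mem hp hξ
  rw [add_zero] at this
  exact this

variable {t : ℕ} (ht : t < d) {N E : GrMod K W} {s c : Fin m → ℤ}
  {β : N.carrier →ₗ[MvPolynomial (Fin d) K] E.carrier}

theorem X_smul_mem_ker_freeπ {q : (E.shift c).free.carrier}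
    (hq : (X ⟨t, ht⟩ : MvPolynomial (Fin d) K) • (E.shift c).freeπ q = 0) :
    (X ⟨t, ht⟩ : MvPolynomial (Fin d) K) • q ∈ LinearMap.ker (E.shift c).freeπ := by
  rw [LinearMap.mem_ker, map_smul, hq]

/-- A cocycle that represents the class of the sequence given by multiplication by `x_{t+1}`
takes the value `y` at `x_{t+1} q`, for every lift `q` of `β y`. -/
theorem cocycle_X_smul (h : IsShortExact (M := E.shift c) β (E.mulShift (X ⟨t, ht⟩) c))
    {σ : (E.shift c).free.carrier →ₗ[MvPolynomial (Fin d) K] E.carrier}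
    {φ : (gHom (E.shift c).syz N).carrier}
    (hσ : E.mulShift (X ⟨t, ht⟩) c ∘ₗ σ = (E.shift c).freeπ)
    (hφ : β ∘ₗ φ.1 = σ ∘ₗ (E.shift c).syzι) {y : N.carrier} {q : (E.shift c).free.carrier}
    (hq : (E.shift c).freeπ q = β y)
    (hz : (X ⟨t, ht⟩ : MvPolynomial (Fin d) K) • q ∈ LinearMap.ker (E.shift c).freeπ) :
    φ.1 ⟨(X ⟨t, ht⟩ : MvPolynomial (Fin d) K) • q, hz⟩ = y := by
  apply h.injective
  -- Writing x for x_{t+1} and π for `freeπ`: βφ(xq) = σ(xq) = xσ(q) = π(q) = βy.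
  have h1 := LinearMap.congr_fun hφ ⟨(X ⟨t, ht⟩ : MvPolynomial (Fin d) K) • q, hz⟩
  have h2 := LinearMap.congr_fun hσ q
  rw [hq] at h2
  rw [← h2]
  refine h1.trans ?_
  exact map_smul σ _ q

/-- A homomorphism on the syzygies of `E(c)` that kills the elements `x_{t+1} q` kills all
syzygies in `F_{t+1} P`. -/
theorem apply_eq_zero_of_mem_faceIdeal_smul
    (hE : ∀ j : Fin d, j.val < t → ∀ x : E.carrier, (X j : MvPolynomial (Fin d) K) • x = 0)
    (hN : ∀ j : Fin d, j.val < t + 1 → ∀ x : N.carrier, (X j : MvPolynomial (Fin d) K) • x = 0)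
    (hsurj : Function.Surjective (E.mulShift (X ⟨t, ht⟩) c))
    {φ : (E.shift c).syz.carrier →ₗ[MvPolynomial (Fin d) K] N.carrier}
    (h0 : ∀ (q : (E.shift c).free.carrier)
      (hz : (X ⟨t, ht⟩ : MvPolynomial (Fin d) K) • q ∈ LinearMap.ker (E.shift c).freeπ),
      φ ⟨(X ⟨t, ht⟩ : MvPolynomial (Fin d) K) • q, hz⟩ = 0)
    (z : (E.shift c).syz.carrier)
    (hz : (z : (E.shift c).free.carrier) ∈ faceIdeal K d (t + 1) •
      (⊤ : Submodule (MvPolynomial (Fin d) K) (E.shift c).free.carrier)) : φ z = 0 := by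
  -- F_t P consists of syzygies because F_t kills E; the claim is that φ vanishes there.
  have hF : ∀ w ∈ faceIdeal K d t •
      (⊤ : Submodule (MvPolynomial (Fin d) K) (E.shift c).free.carrier),
      ∃ hw : w ∈ LinearMap.ker (E.shift c).freeπ, φ ⟨w, hw⟩ = 0 := by
    intro w hw
    induction hw using Submodule.smul_induction_on' with
    | add x _ y _ h1 h2 =>
      obtain ⟨hx, hx'⟩ := h1
      obtain ⟨hy, hy'⟩ := h2
      refine ⟨add_mem hx hy, ?_⟩
      have : (⟨x + y, add_mem hx hy⟩ : (E.shift c).syz.carrier) = ⟨x, hx⟩ + ⟨y, hy⟩ := rfl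
      rw [this, map_add, hx', hy', add_zero]
    | smul p hp q _ =>
      induction hp using Submodule.span_induction generalizing q with
      | zero =>
        refine ⟨by simp, ?_⟩
        have : (⟨(0 : MvPolynomial (Fin d) K) • q, by simp⟩ : (E.shift c).syz.carrier) = 0 :=
          Subtype.ext (zero_smul _ q)
        rw [this, map_zero]
      | add p p' _ _ h1 h2 =>
        obtain ⟨hx, hx'⟩ := h1 q trivial
        obtain ⟨hy, hy'⟩ := h2 q trivial
        refine ⟨add_smul p p' q ▸ add_mem hx hy, ?_⟩
        have : (⟨(p + p') • q, add_smul p p' q ▸ add_mem hx hy⟩ : (E.shift c).syz.carrier) =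
            ⟨p • q, hx⟩ + ⟨p' • q, hy⟩ := Subtype.ext (add_smul p p' q)
        rw [this, map_add, hx', hy', add_zero]
      | smul a p _ h =>
        obtain ⟨hx, hx'⟩ := h (a • q) trivial
        have he : (a • p) • q = p • a • q := by rw [smul_eq_mul, mul_comm, mul_smul]
        refine ⟨he ▸ hx, ?_⟩
        rw [← hx']
        exact congrArg φ (Subtype.ext he)
      | mem p hp =>
        obtain ⟨j, hj, rfl⟩ := hp
        have hker : ∀ q : (E.shift c).free.carrier,
            (X j : MvPolynomial (Fin d) K) • q ∈ LinearMap.ker (E.shift c).freeπ := fun q => by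
          rw [LinearMap.mem_ker, map_smul]
          exact hE j hj _
        refine ⟨hker q, ?_⟩
        -- Divisibility of E by x = x_{t+1} gives q = z + xq' with z a syzygy. Then x_j q = x_j z +
        -- x(x_j q') lies in F_{t+1}Z, which φ kills because F_{t+1} kills N.
        obtain ⟨e, he⟩ := hsurj ((E.shift c).freeπ q)
        obtain ⟨q', rfl⟩ := freeπ_surjective (E.shift c) e
        have hq' : q - (X ⟨t, ht⟩ : MvPolynomial (Fin d) K) • q' ∈
            LinearMap.ker (E.shift c).freeπ := by
          rw [LinearMap.mem_ker, map_sub, map_smul, sub_eq_zero]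
          exact he.symm
        have h1 : (⟨(X j : MvPolynomial (Fin d) K) • q, hker q⟩ : (E.shift c).syz.carrier) =
            (X j : MvPolynomial (Fin d) K) •
              ⟨q - (X ⟨t, ht⟩ : MvPolynomial (Fin d) K) • q', hq'⟩ +
            (X ⟨t, ht⟩ : MvPolynomial (Fin d) K) •
              ⟨(X j : MvPolynomial (Fin d) K) • q', hker q'⟩ := by
          apply Subtype.ext
          change (X j : MvPolynomial (Fin d) K) • q =
            (X j : MvPolynomial (Fin d) K) • (q - (X ⟨t, ht⟩ : MvPolynomial (Fin d) K) • q') +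
            (X ⟨t, ht⟩ : MvPolynomial (Fin d) K) • (X j : MvPolynomial (Fin d) K) • q'
          rw [smul_sub, smul_comm (X ⟨t, ht⟩ : MvPolynomial (Fin d) K), sub_add_cancel]
        rw [h1, map_add, map_smul, map_smul, hN j (Nat.lt_succ_of_lt hj),
          hN ⟨t, ht⟩ (Nat.lt_succ_self t), add_zero]
  obtain ⟨z, hzk⟩ := z
  obtain ⟨q, w, hw, hzq⟩ := exists_eq_smul_add_of_mem_faceIdeal_smul ht hz
  change z = _ at hzq
  subst hzq
  obtain ⟨hw', hw0⟩ := hF w hw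
  have hq : (X ⟨t, ht⟩ : MvPolynomial (Fin d) K) • q ∈ LinearMap.ker (E.shift c).freeπ := by
    have := sub_mem hzk hw'
    rwa [add_sub_cancel_right] at this
  have h1 : (⟨(X ⟨t, ht⟩ : MvPolynomial (Fin d) K) • q + w, hzk⟩ : (E.shift c).syz.carrier) =
      ⟨_, hq⟩ + ⟨w, hw'⟩ := rfl
  rw [h1, map_add, hw0, h0, add_zero]

/-- A homogeneous homomorphism on the syzygies of `E(c)` induces an endomorphism of `N`. -/
theorem exists_induced_endomorphism
    (hN : ∀ x : N.carrier, (X ⟨t, ht⟩ : MvPolynomial (Fin d) K) • x = 0)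
    (h : IsShortExact (M := E.shift (wt W ⟨t, ht⟩)) β (E.mulShift (X ⟨t, ht⟩) (wt W ⟨t, ht⟩)))
    {g : Fin m → ℤ} :
    ∀ φ ∈ homDeg (E.shift (wt W ⟨t, ht⟩)).syz N g,
      ∃ f ∈ homDeg N N g, ∀ (y : N.carrier) (q : (E.shift (wt W ⟨t, ht⟩)).free.carrier)
      (hz : (X ⟨t, ht⟩ : MvPolynomial (Fin d) K) • q ∈
        LinearMap.ker (E.shift (wt W ⟨t, ht⟩)).freeπ),
      (E.shift (wt W ⟨t, ht⟩)).freeπ q = β y → φ ⟨_, hz⟩ = f y := by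
  set M := E.shift (wt W ⟨t, ht⟩) with hM
  intro φ hφ
  have hβ : ∀ y, (X ⟨t, ht⟩ : MvPolynomial (Fin d) K) • β y = 0 := fun y =>
    (h.exact (β y)).2 ⟨y, rfl⟩
  have hker : ∀ {y : N.carrier} {q : M.free.carrier}, M.freeπ q = β y →
      (X ⟨t, ht⟩ : MvPolynomial (Fin d) K) • q ∈ LinearMap.ker M.freeπ := by
    intro y q hq
    refine X_smul_mem_ker_freeπ ht ?_
    rw [hq]
    exact hβ y
  -- Two lifts differ by a syzygy z, and φ(xz) = xφ(z) = 0.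
  have huniq : ∀ {q q' : M.free.carrier}
      (hz : (X ⟨t, ht⟩ : MvPolynomial (Fin d) K) • q ∈ LinearMap.ker M.freeπ)
      (hz' : (X ⟨t, ht⟩ : MvPolynomial (Fin d) K) • q' ∈ LinearMap.ker M.freeπ),
      M.freeπ q = M.freeπ q' → φ ⟨_, hz⟩ = φ ⟨_, hz'⟩ := by
    intro q q' hz hz' hqq
    have hk : q - q' ∈ LinearMap.ker M.freeπ := by
      rw [LinearMap.mem_ker, map_sub, hqq, sub_self]
    rw [← sub_eq_zero, ← map_sub, ← hN (φ ⟨q - q', hk⟩), ← map_smul]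
    exact congrArg φ (Subtype.ext (smul_sub _ _ _).symm)
  choose q hq using fun y => M.freeπ_surjective (β y)
  let f : N.carrier →ₗ[MvPolynomial (Fin d) K] N.carrier :=
    { toFun := fun y => φ ⟨_, hker (hq y)⟩
      map_add' := fun x y => by
        have h1 : M.freeπ (q x + q y) = β (x + y) := by rw [map_add, map_add, hq, hq]
        rw [huniq (hker (hq (x + y))) (hker h1) (by rw [hq, h1]), ← map_add]
        exact congrArg φ (Subtype.ext (smul_add _ _ _))
      map_smul' := fun p x => by
        have h1 : M.freeπ (p • q x) = β (p • x) := by rw [map_smul, map_smul, hq]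
        rw [huniq (hker (hq (p • x))) (hker h1) (by rw [hq, h1]), RingHom.id_apply, ← map_smul]
        exact congrArg φ (Subtype.ext (smul_comm _ _ _)) }
  refine ⟨f, fun k y hy => ?_, fun y q' hz hq' => huniq _ _ (by rw [hq', hq])⟩
  -- The lift can be chosen homogeneous. The twist puts βy in degree k - c of M, and multiplication
  -- by x restores degree k.
  have hy' : β y ∈ M.gr (k - wt W ⟨t, ht⟩) := by
    change β y ∈ E.gr (k - wt W ⟨t, ht⟩ + wt W ⟨t, ht⟩)
    rw [sub_add_cancel]
    exact h.gr_left _ _ hy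
  obtain ⟨q', hq'g, hq'⟩ := exists_mem_gr_freeπ_eq hy'
  have h1 : f y = φ ⟨_, hker hq'⟩ := huniq _ _ (by rw [hq', hq])
  rw [h1]
  refine hφ k _ ?_
  have := M.free.smul_mem (X_mem (K := K) (W := W) ⟨t, ht⟩) hq'g
  rwa [add_sub_cancel] at this

/-- If p times the class is zero, then pφ extends to some ψ on P. Evaluating at xq, with q a lift of
βy, gives py = ψ(xq) = xψ(q) = 0 for all y, so p annihilates N and lies in F_{t+1}. -/
theorem faceRingToExt_injective (ε : SocleFunctional N (t + 1) s)
    (h : IsShortExact (M := E.shift c) β (E.mulShift (X ⟨t, ht⟩) c)) :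
    Function.Injective (faceRingToExt ε.X_smul (extClass h)) := by
  rw [injective_iff_map_eq_zero]
  intro x hx
  obtain ⟨p, rfl⟩ := Submodule.Quotient.mk_surjective _ x
  rw [faceRingToExt_mk] at hx
  obtain ⟨σ, φ, -, hσ, hφ, hξ⟩ := isExtClass_extClass h
  rw [hξ, ← Submodule.Quotient.mk_smul, Submodule.Quotient.mk_eq_zero] at hx
  obtain ⟨ψ, hψ⟩ := hx
  rw [Submodule.Quotient.mk_eq_zero]
  refine ε.mem_faceIdeal_of_smul_eq_zero fun y => ?_
  obtain ⟨q, hq⟩ := (E.shift c).freeπ_surjective (β y)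
  have hz : (X ⟨t, ht⟩ : MvPolynomial (Fin d) K) • q ∈ LinearMap.ker (E.shift c).freeπ := by
    refine X_smul_mem_ker_freeπ ht ?_
    rw [hq]
    exact (h.exact (β y)).2 ⟨y, rfl⟩
  have h1 := LinearMap.congr_fun (congrArg Subtype.val hψ)
    (⟨(X ⟨t, ht⟩ : MvPolynomial (Fin d) K) • q, hz⟩ : (E.shift c).syz.carrier)
  have h2 : ψ.1 ((X ⟨t, ht⟩ : MvPolynomial (Fin d) K) • q) = p • φ.1 ⟨_, hz⟩ := h1
  rw [cocycle_X_smul ht h hσ hφ hq hz, map_smul, ε.X_smul _ (Nat.lt_succ_self t)] at h2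
  exact h2.symm

/-- A homogeneous cocycle φ induces multiplication by some p on N, as does pφ₀ for the cocycle φ₀ of
the sequence. The difference induces 0, hence vanishes on Z ∩ F_{t+1}P and extends to P, so it is a
coboundary. -/
theorem faceRingToExt_surjective (hW : IsPositiveType W) (ε : SocleFunctional N (t + 1) s)
    (hE : ∀ j : Fin d, j.val < t → ∀ x : E.carrier, (X j : MvPolynomial (Fin d) K) • x = 0)
    (h : IsShortExact (M := E.shift (wt W ⟨t, ht⟩)) β (E.mulShift (X ⟨t, ht⟩) (wt W ⟨t, ht⟩))) :
    Function.Surjective (faceRingToExt ε.X_smul (extClass h)) := by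
  set M := E.shift (wt W ⟨t, ht⟩) with hM
  obtain ⟨σ, φ₀, hσg, hσ, hφ₀, hξ⟩ := isExtClass_extClass h
  intro η
  obtain ⟨φ, rfl⟩ := Submodule.Quotient.mk_surjective _ η
  induction φ using gr_induction (M := gHom M.syz N) with
  | h0 => exact ⟨0, by rw [map_zero, Submodule.Quotient.mk_zero]⟩
  | hadd φ φ' h1 h2 =>
    obtain ⟨a, ha⟩ := h1
    obtain ⟨b, hb⟩ := h2
    exact ⟨a + b, by rw [map_add, ha, hb, Submodule.Quotient.mk_add]⟩
  | hgr g φ hφ =>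
    obtain ⟨f, hf, hfφ⟩ := exists_induced_endomorphism ht (ε.X_smul _ (Nat.lt_succ_self t)) h
      φ.1 hφ
    obtain ⟨p, hp, hpf⟩ := ε.exists_eq_smul_of_mem_homDeg hW hf
    have hφ₀g := cocycle_mem_homDeg h hσg hφ₀
    have hdeg : φ.1 - p • φ₀.1 ∈ homDeg M.syz N g := by
      have := smul_mem_homDeg hp hφ₀g
      rw [add_zero] at this
      exact sub_mem hφ this
    obtain ⟨ψ, hψ, hψφ⟩ := ε.exists_extension hW (L := M.free) (LinearMap.ker M.freeπ)
      (isHomogeneous_ker M.freeπ_isGr) hdeg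
      (apply_eq_zero_of_mem_faceIdeal_smul ht hE ε.X_smul h.surjective (fun q hz => by
        have h0 : (X ⟨t, ht⟩ : MvPolynomial (Fin d) K) • M.freeπ q = 0 := by
          rw [← map_smul]
          exact hz
        obtain ⟨y, hy⟩ := (h.exact (M.freeπ q)).1 h0
        rw [LinearMap.sub_apply, LinearMap.smul_apply, hfφ y q hz hy.symm, hpf,
          cocycle_X_smul ht h hσ hφ₀ hy.symm hz, sub_self]))
    refine ⟨Submodule.Quotient.mk p, ?_⟩
    rw [faceRingToExt_mk, hξ, ← Submodule.Quotient.mk_smul, eq_comm, Submodule.Quotient.eq]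
    exact ⟨⟨ψ, AddSubgroup.mem_iSup_of_mem g hψ⟩, Subtype.ext (LinearMap.ext hψφ)⟩

/-- If `E` is annihilated by `F_t` and multiplication by `x_{t+1}` on `E` has the kernel `N`, a
twisted graded dual of `A / F_{t+1}`, then `*Ext¹_A(E(c), N)` is free over `A / F_{t+1}` on the
class of the sequence. -/
theorem exists_iso_gExt1 (hW : IsPositiveType W) (ε : SocleFunctional N (t + 1) s)
    (hE : ∀ j : Fin d, j.val < t → ∀ x : E.carrier, (X j : MvPolynomial (Fin d) K) • x = 0)
    (h : IsShortExact (M := E.shift (wt W ⟨t, ht⟩)) β (E.mulShift (X ⟨t, ht⟩) (wt W ⟨t, ht⟩))) :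
    ∃ e : Iso (faceRing K W (t + 1)) (gExt1 (E.shift (wt W ⟨t, ht⟩)) N),
      e.toEquiv (Ideal.Quotient.mk (faceIdeal K d (t + 1)) 1) = extClass h :=
  ⟨Iso.ofBijective (faceRingToExt ε.X_smul (extClass h)) (faceRingToExt_isGr _ (extClass_mem_gr h))
    ⟨faceRingToExt_injective ht ε h, faceRingToExt_surjective ht hW ε hE h⟩,
    one_smul (MvPolynomial (Fin d) K) (extClass h)⟩

end ExtOfMultiplication

/-! ### Removing the twist of the second argument -/

section Twist

theorem mem_homDeg_shift {M N : GrMod K W} {c g : Fin m → ℤ}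
    {f : M.carrier →ₗ[MvPolynomial (Fin d) K] N.carrier} :
    f ∈ homDeg M (N.shift c) g ↔ f ∈ homDeg M N (g + c) := by
  have : ∀ k x, f x ∈ (N.shift c).gr (k + g) ↔ f x ∈ N.gr (k + (g + c)) := fun k x => by
    rw [← add_assoc]
  exact forall_congr' fun k => forall_congr' fun x => imp_congr_right fun _ => this k x

/-- Twisting only reindexes the family of homogeneous maps, so the supremum is literally the same
submodule. -/
theorem homSubmodule_shift (M N : GrMod K W) (c : Fin m → ℤ) :
    homSubmodule M (N.shift c) = homSubmodule M N := by
  have h : (⨆ g, homDeg M (N.shift c) g) = ⨆ g, homDeg M N g := by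
    rw [← (Equiv.addRight c).iSup_comp (g := fun g => homDeg M N g)]
    exact iSup_congr fun g => AddSubgroup.ext fun f => mem_homDeg_shift
  ext f
  change f ∈ (⨆ g, homDeg M (N.shift c) g) ↔ f ∈ ⨆ g, homDeg M N g
  rw [h]

/-- `*Ext¹_A(M, N(c)) = *Ext¹_A(M, N)(c)`. -/
theorem nonempty_iso_gExt1_shift (M N : GrMod K W) (c : Fin m → ℤ) :
    Nonempty (Iso (gExt1 M (N.shift c)) ((gExt1 M N).shift c)) := by
  let e : ∀ L, (gHom L (N.shift c)).carrier ≃ₗ[MvPolynomial (Fin d) K] (gHom L N).carrier :=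
    fun L => LinearEquiv.ofEq _ _ (homSubmodule_shift L N c)
  have he : Submodule.map (e M.syz).toLinearMap
      (LinearMap.range (gHomPrecomp M.syzι M.syzι_isGr (N.shift c))) =
      LinearMap.range (gHomPrecomp M.syzι M.syzι_isGr N) := by
    ext f
    constructor
    · rintro ⟨_, ⟨ψ, rfl⟩, rfl⟩
      exact ⟨e M.free ψ, rfl⟩
    · rintro ⟨ψ, rfl⟩
      exact ⟨_, ⟨(e M.free).symm ψ, rfl⟩, rfl⟩
  let E : (gExt1 M (N.shift c)).carrier ≃ₗ[MvPolynomial (Fin d) K] (gExt1 M N).carrier :=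
    Submodule.Quotient.equiv _ _ (e M.syz) he
  have hE : IsGr (M := gExt1 M (N.shift c)) (N := (gExt1 M N).shift c) E.toLinearMap := by
    rintro g _ ⟨f, hf, rfl⟩
    exact ⟨e M.syz f, mem_homDeg_shift.1 hf, rfl⟩
  exact ⟨Iso.ofBijective E.toLinearMap hE E.bijective⟩

/-- An isomorphism `M ≅ N(c)` is an isomorphism `M(-c) ≅ N`. -/
noncomputable def Iso.unshift {M N : GrMod K W} {c : Fin m → ℤ} (e : Iso M (N.shift c)) :
    Iso (M.shift (-c)) N where
  toEquiv := e.toEquiv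
  mem_iff g x := by
    have := e.mem_iff (g + -c) x
    change e.toEquiv x ∈ N.gr (g + -c + c) ↔ _ at this
    rw [neg_add_cancel_right] at this
    exact this

/-- Composition of isomorphisms of graded modules. -/
noncomputable def Iso.trans {L M N : GrMod K W} (e : Iso L M) (f : Iso M N) : Iso L N where
  toEquiv := e.toEquiv.trans f.toEquiv
  mem_iff g x := (f.mem_iff g _).trans (e.mem_iff g x)

end Twist

/-! ### Existence of the short exact sequence -/

section Injection

/-- The graded dual of `A / F_{t+1}` is the kernel of `x_{t+1}` on the graded dual of `A / F_t`. -/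
theorem SocleFunctional.exists_isShortExact (hW : IsPositiveType W) {t : ℕ} (ht : t < d)
    {E N : GrMod K W} {s : Fin m → ℤ} (ε : SocleFunctional E t s)
    (ε' : SocleFunctional N (t + 1) s) :
    ∃ β : N.carrier →ₗ[MvPolynomial (Fin d) K] E.carrier,
      IsShortExact (M := E.shift (wt W ⟨t, ht⟩)) β (E.mulShift (X ⟨t, ht⟩) (wt W ⟨t, ht⟩)) := by
  obtain ⟨β, hβ, hεβ⟩ := ε.exists_lift hW ε'.toFun ε'.map_C_smul ε'.eq_of_ne_zero
    (fun j hj x => by rw [ε'.X_smul j (Nat.lt_succ_of_lt hj), map_zero])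
  rw [sub_self] at hβ
  have hX : ∀ n (x : E.carrier), (monomial n 1 : MvPolynomial (Fin d) K) •
      (X ⟨t, ht⟩ : MvPolynomial (Fin d) K) • x =
      (monomial (n + Finsupp.single ⟨t, ht⟩ 1) 1 : MvPolynomial (Fin d) K) • x := by
    intro n x
    rw [← mul_smul, X, monomial_mul, one_mul]
  refine ⟨β, fun g x hx => by simpa using hβ g x hx, fun g x hx => ?_, ?_, fun x => ⟨?_, ?_⟩, ?_⟩
  · have := E.smul_mem (X_mem (K := K) (W := W) ⟨t, ht⟩) hx
    rw [add_comm] at this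
    exact this
  · rw [injective_iff_map_eq_zero]
    intro y hy
    refine ε'.eq_zero y fun n => ?_
    rw [← hεβ, map_smul, hy, smul_zero, map_zero]
  · intro hx
    have hx' : (X ⟨t, ht⟩ : MvPolynomial (Fin d) K) • x = 0 := hx
    -- An element killed by x_{t+1} has zero coordinates at all monomials in F_{t+1}, so its
    -- coordinates are those of an element of N.
    obtain ⟨y, hy⟩ := ε'.exists_eq
      (fun n => ε.toFun ((monomial n 1 : MvPolynomial (Fin d) K) • x))
      (finite_setOf_ne_zero hW ε.toFun ε.eq_of_ne_zero x) (fun n j hj hn => by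
        rw [monomial_eq_X_mul hn, mul_comm, mul_smul]
        rcases Nat.lt_succ_iff_lt_or_eq.1 hj with hj | hj
        · rw [ε.X_smul j hj, smul_zero, map_zero]
        · obtain rfl : j = ⟨t, ht⟩ := Fin.ext hj
          rw [hx', smul_zero, map_zero])
    exact ⟨y, ε.ext fun n => by rw [← map_smul, hεβ, hy]⟩
  · rintro ⟨y, rfl⟩
    change (X ⟨t, ht⟩ : MvPolynomial (Fin d) K) • β y = 0
    rw [← map_smul, ε'.X_smul _ (Nat.lt_succ_self t), map_zero]
  · intro x
    -- Division by x_{t+1} shifts coordinates up in the index t. The coordinates where that exponent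
    -- is 0 are free and set to 0.
    obtain ⟨y, hy⟩ := ε.exists_eq (fun n => if n ⟨t, ht⟩ = 0 then 0 else
      ε.toFun ((monomial (n - Finsupp.single ⟨t, ht⟩ 1) 1 : MvPolynomial (Fin d) K) • x))
      (((finite_setOf_ne_zero hW ε.toFun ε.eq_of_ne_zero x).image
        (· + Finsupp.single ⟨t, ht⟩ 1)).subset fun n hn => by
          have hn1 : n ⟨t, ht⟩ ≠ 0 := fun h => hn (if_pos h)
          refine ⟨n - Finsupp.single ⟨t, ht⟩ 1, fun h => hn (by simp only [h, ite_self]), ?_⟩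
          refine tsub_add_cancel_of_le ?_
          simpa [Nat.one_le_iff_ne_zero] using hn1) (fun n j hj hn => by
        have hjt : (⟨t, ht⟩ : Fin d) ≠ j := by
          rintro rfl
          exact lt_irrefl _ hj
        rw [ε.monomial_smul_eq_zero hj (by simpa [hjt] using hn), map_zero, ite_self])
    refine ⟨y, ε.ext fun n => ?_⟩
    change ε.toFun ((monomial n 1 : MvPolynomial (Fin d) K) •
      (X ⟨t, ht⟩ : MvPolynomial (Fin d) K) • y) = _
    rw [hX, hy, if_neg (by simp), add_tsub_cancel_right]

end Injection

/-! ### Q_t as inverse monomials: the end of the Čech complex -/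

section TopCohomology

/-- The exponent of the monomial `∏_{j ∈ S} x_j`. -/
noncomputable def expS {d : ℕ} (S : Finset (Fin d)) : Fin d →₀ ℕ :=
  ∑ j ∈ S, Finsupp.single j 1

theorem expS_apply (S : Finset (Fin d)) (j : Fin d) : expS S j = if j ∈ S then 1 else 0 := by
  classical
  rw [expS, Finsupp.finsetSum_apply]
  simp [Finsupp.single_apply]

theorem xS_pow_eq (S : Finset (Fin d)) (n : ℕ) : xS K S ^ n = monomial (n • expS S) 1 := by
  rw [xS, expS, ← one_pow (M := K) n, ← monomial_pow, monomial_sum_one]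
  simp [X]

/-- The indices of the variables outside `F_t`. -/
def faceCompl (d t : ℕ) : Finset (Fin d) := Finset.univ.filter fun j => t ≤ j.val

theorem mem_faceCompl {t : ℕ} {j : Fin d} : j ∈ faceCompl d t ↔ t ≤ j.val := by
  simp [faceCompl]

theorem card_faceCompl {t : ℕ} (ht : t ≤ d) : ((faceCompl d t).card : ℤ) = (d : ℤ) - t := by
  rcases ht.lt_or_eq with h | rfl
  · have : faceCompl d t = Finset.Ici ⟨t, h⟩ := by
      ext j
      rw [mem_faceCompl, Finset.mem_Ici, Fin.le_def]
    rw [this, Fin.card_Ici]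
    change ((d - t : ℕ) : ℤ) = d - t
    omega
  · rw [Finset.card_eq_zero.2 (Finset.eq_empty_of_forall_notMem fun j hj =>
      absurd (mem_faceCompl.1 hj) (not_le.2 j.2))]
    simp

theorem eq_faceCompl_of_card {t : ℕ} (ht : t ≤ d) {S : Finset (Fin d)}
    (hS : (S.card : ℤ) = (d : ℤ) - t) (h : ∀ j ∈ S, t ≤ j.val) : S = faceCompl d t := by
  refine Finset.eq_of_subset_of_card_le (fun j hj => mem_faceCompl.2 (h j hj)) ?_
  have := card_faceCompl ht
  omega

theorem xS_singleton (j : Fin d) : xS K {j} = X j :=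
  Finset.prod_singleton _ _

theorem xS_smul_faceRing {t : ℕ} {S : Finset (Fin d)} {j : Fin d} (hj : j ∈ S) (hjt : j.val < t)
    (x : (faceRing K W t).carrier) : xS K S • x = 0 := by
  obtain ⟨p, rfl⟩ := Submodule.Quotient.mk_surjective _ x
  rw [← Submodule.Quotient.mk_smul, Submodule.Quotient.mk_eq_zero, smul_eq_mul]
  refine Ideal.mul_mem_right _ _ ?_
  rw [xS, ← Finset.mul_prod_erase _ _ hj]
  exact Ideal.mul_mem_right _ _ (X_mem_faceIdeal hjt)

/-- Inverting a variable of F_t annihilates A/F_t. In degree d - t only the set `faceCompl d t`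
survives, and in higher degrees nothing does. -/
theorem cechTerm_faceRing_eq_zero {t : ℕ} {S : Finset (Fin d)} {j : Fin d} (hj : j ∈ S)
    (hjt : j.val < t) (z : ((faceRing K W t).cechTerm S).carrier) : z = 0 := by
  induction z using LocalizedModule.induction_on with
  | h x a =>
    rw [← LocalizedModule.zero_mk a, LocalizedModule.mk_eq]
    refine ⟨spow (xS K S) 1, ?_⟩
    have h : ∀ y : (faceRing K W t).carrier, spow (xS K S) 1 • y = 0 := fun y => by
      change (xS K S ^ 1) • y = 0
      rw [pow_one]
      exact xS_smul_faceRing hj hjt y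
    rw [h, h]

/-- The map `x ↦ x / x_S ^ n` into the localization, for fixed `n`. -/
noncomputable def divMap (M : GrMod K W) (S : Finset (Fin d)) (n : ℕ) :
    M.carrier →ₗ[MvPolynomial (Fin d) K] (M.cechTerm S).carrier where
  toFun x := LocalizedModule.mk x (spow (xS K S) n)
  map_add' x y := mk_add x y _
  map_smul' p x := (LocalizedModule.smul'_mk p x _).symm

/-- The elements `p / x_S ^ n` of the localization of `A / F_t`, for fixed `n`. -/
noncomputable def fracMap (K : Type u) [Field K] {m d : ℕ} (W : Matrix (Fin m) (Fin d) ℤ) (t : ℕ)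
    (S : Finset (Fin d)) (n : ℕ) :
    MvPolynomial (Fin d) K →ₗ[MvPolynomial (Fin d) K] ((faceRing K W t).cechTerm S).carrier :=
  (faceRing K W t).divMap S n ∘ₗ (faceIdeal K d t).mkQ

theorem fracMap_apply {t : ℕ} (S : Finset (Fin d)) (n : ℕ) (p : MvPolynomial (Fin d) K) :
    fracMap K W t S n p = LocalizedModule.mk
      (Submodule.Quotient.mk p : (faceRing K W t).carrier) (spow (xS K S) n) :=
  rfl

theorem exists_fracMap_eq {t : ℕ} {S : Finset (Fin d)}
    (z : ((faceRing K W t).cechTerm S).carrier) : ∃ n p, fracMap K W t S n p = z := by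
  induction z using LocalizedModule.induction_on with
  | h x a =>
    obtain ⟨_, n, rfl⟩ := a
    obtain ⟨p, rfl⟩ := Submodule.Quotient.mk_surjective _ x
    exact ⟨n, p, rfl⟩

theorem exists_fracMap_eq_of_mem_gr {t : ℕ} {S : Finset (Fin d)} {g : Fin m → ℤ}
    {z : ((faceRing K W t).cechTerm S).carrier} (hz : z ∈ ((faceRing K W t).cechTerm S).gr g) :
    ∃ n, ∃ p ∈ polyGr K W (g + n • ∑ j ∈ S, wt W j), fracMap K W t S n p = z := by
  obtain ⟨n, x, ⟨p, hp, rfl⟩, rfl⟩ := hz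
  exact ⟨n, p, hp, rfl⟩

theorem fracMap_eq_iff {t : ℕ} {S : Finset (Fin d)} {n k : ℕ} {p q : MvPolynomial (Fin d) K} :
    fracMap K W t S n p = fracMap K W t S k q ↔
      ∃ l, xS K S ^ l * (xS K S ^ k * p - xS K S ^ n * q) ∈ faceIdeal K d t := by
  rw [fracMap_apply, fracMap_apply, LocalizedModule.mk_eq]
  have h : ∀ l : ℕ, spow (xS K S) l • spow (xS K S) k •
        (Submodule.Quotient.mk p : (faceRing K W t).carrier) =
      spow (xS K S) l • spow (xS K S) n • (Submodule.Quotient.mk q : (faceRing K W t).carrier) ↔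
      xS K S ^ l * (xS K S ^ k * p - xS K S ^ n * q) ∈ faceIdeal K d t := by
    intro l
    rw [mul_sub]
    exact Submodule.Quotient.eq (faceIdeal K d t) (x := xS K S ^ l * (xS K S ^ k * p))
      (y := xS K S ^ l * (xS K S ^ n * q))
  constructor
  · rintro ⟨⟨_, l, rfl⟩, hl⟩
    exact ⟨l, (h l).1 hl⟩
  · rintro ⟨l, hl⟩
    exact ⟨spow (xS K S) l, (h l).2 hl⟩

theorem fracMap_add_pow {t : ℕ} (S : Finset (Fin d)) (n k : ℕ) (p : MvPolynomial (Fin d) K) :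
    fracMap K W t S (n + k) (xS K S ^ k * p) = fracMap K W t S n p := by
  refine fracMap_eq_iff.2 ⟨0, ?_⟩
  rw [pow_add, mul_assoc, sub_self, mul_zero]
  exact zero_mem _

theorem fracMap_eq_zero_of_mem {t : ℕ} (S : Finset (Fin d)) (n : ℕ) {p : MvPolynomial (Fin d) K}
    (hp : p ∈ faceIdeal K d t) : fracMap K W t S n p = 0 := by
  have h0 : (Submodule.Quotient.mk p : (faceRing K W t).carrier) = 0 :=
    (Submodule.Quotient.mk_eq_zero (faceIdeal K d t)).2 hp
  rw [fracMap_apply, h0, LocalizedModule.zero_mk]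

theorem cechRes_fracMap {t : ℕ} {S T : Finset (Fin d)} (h : S ⊆ T) (n : ℕ)
    (p : MvPolynomial (Fin d) K) :
    (faceRing K W t).cechRes h (fracMap K W t S n p) =
      fracMap K W t T n (xS K (T \ S) ^ n * p) := by
  change LocalizedModule.lift _ _ _ (LocalizedModule.mk _ (spow (xS K S) n)) = _
  rw [LocalizedModule.lift_mk, Module.End.algebraMap_isUnit_inv_apply_eq_iff]
  change _ = xS K S ^ n • fracMap K W t T n (xS K (T \ S) ^ n * p)
  have hT : xS K S ^ n * xS K (T \ S) ^ n = xS K T ^ n := by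
    rw [← mul_pow, mul_comm, xS, xS, xS, Finset.prod_sdiff h]
  rw [← map_smul, smul_eq_mul, ← mul_assoc, hT]
  have := fracMap_add_pow (W := W) (t := t) T 0 n p
  rw [zero_add] at this
  rw [this]
  rfl

/-! ### Polar parts and coboundaries -/

/-- The polynomial `p` has no monomial `x ^ e` outside `F_t` with all exponents less than `n`, so
that `p / (∏_{j ≥ t} x_j) ^ n` has no polar part. -/
def NoPolarPart (t n : ℕ) (p : MvPolynomial (Fin d) K) : Prop :=
  ∀ e : Fin d →₀ ℕ, (∀ j : Fin d, j.val < t → e j = 0) → (∀ j : Fin d, t ≤ j.val → e j < n) →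
    coeff e p = 0

/-- Independence of the representation. Cross-multiplying shifts the exponents outside F_t by n - k,
which carries the range e_j < k to e_j < n. -/
theorem NoPolarPart.of_fracMap_eq {t n k : ℕ} {p q : MvPolynomial (Fin d) K}
    (hp : NoPolarPart t n p)
    (h : fracMap K W t (faceCompl d t) n p = fracMap K W t (faceCompl d t) k q) :
    NoPolarPart t k q := by
  obtain ⟨l, hl⟩ := fracMap_eq_iff.1 h
  intro e he hek
  rw [mul_sub, ← mul_assoc, ← mul_assoc, ← pow_add, ← pow_add, xS_pow_eq, xS_pow_eq] at hl
  have h1 := mem_faceIdeal_iff.1 hl ((l + n) • expS (faceCompl d t) + e) fun j hj => by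
    simp [expS_apply, mem_faceCompl, he j hj, hj.not_ge]
  rw [coeff_sub, coeff_monomial_mul, one_mul, coeff_monomial_mul', sub_eq_zero] at h1
  rw [← h1]
  split_ifs with hle
  · rw [one_mul]
    refine hp _ (fun j hj => by simp [expS_apply, mem_faceCompl, he j hj, hj.not_ge]) fun j hj => ?_
    have h2 := hle j
    have h3 := hek j hj
    simp only [Finsupp.coe_tsub, Finsupp.coe_add, Finsupp.coe_smul, Pi.sub_apply, Pi.add_apply,
      Pi.smul_apply, expS_apply, mem_faceCompl.2 hj, if_true, smul_eq_mul, mul_one] at h2 ⊢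
    omega
  · rfl

theorem NoPolarPart.add {t n : ℕ} {p q : MvPolynomial (Fin d) K} (hp : NoPolarPart t n p)
    (hq : NoPolarPart t n q) : NoPolarPart t n (p + q) := fun e he he' => by
  rw [coeff_add, hp e he he', hq e he he', add_zero]

/-- The fractions without polar part. -/
noncomputable def noPolarPart (K : Type u) [Field K] {m d : ℕ} (W : Matrix (Fin m) (Fin d) ℤ)
    (t : ℕ) : AddSubgroup ((faceRing K W t).cechTerm (faceCompl d t)).carrier where
  carrier := {z | ∀ n p, fracMap K W t (faceCompl d t) n p = z → NoPolarPart t n p}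
  zero_mem' := fun n p h => by
    have h0 : NoPolarPart t n (0 : MvPolynomial (Fin d) K) := fun e _ _ => coeff_zero e
    exact h0.of_fracMap_eq (W := W) (k := n) (q := p) (by rw [h, map_zero])
  add_mem' := by
    intro z w hz hw n p h
    obtain ⟨a, q, rfl⟩ := exists_fracMap_eq z
    obtain ⟨b, r, rfl⟩ := exists_fracMap_eq w
    have h1 := hz (a + b) _ (fracMap_add_pow _ a b q)
    have h2 := hw (a + b) (xS K (faceCompl d t) ^ a * r) (by
      rw [add_comm]
      exact fracMap_add_pow _ b a r)
    refine (h1.add h2).of_fracMap_eq (W := W) ?_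
    rw [h, map_add, fracMap_add_pow, add_comm a b, fracMap_add_pow]
  neg_mem' := by
    intro z hz n p h e he he'
    have := hz n (-p) (by rw [map_neg, h, neg_neg]) e he he'
    rwa [coeff_neg, neg_eq_zero] at this

/-- A fraction without x_k in its denominator becomes x_k^n p / x_S^n over the full denominator,
where every monomial of the numerator has x_k-exponent at least n. -/
theorem cechRes_mem_noPolarPart {t : ℕ} {k : Fin d} (hk : k ∈ faceCompl d t)
    (z : ((faceRing K W t).cechTerm ((faceCompl d t).erase k)).carrier) :
    (faceRing K W t).cechRes (Finset.erase_subset k _) z ∈ noPolarPart K W t := by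
  obtain ⟨n, p, rfl⟩ := exists_fracMap_eq z
  rw [cechRes_fracMap, Finset.sdiff_erase_self hk]
  intro a q hq
  refine NoPolarPart.of_fracMap_eq (W := W) (fun e _ he' => ?_) hq.symm
  rw [xS_pow_eq, coeff_monomial_mul', if_neg]
  intro hle
  have h1 := hle k
  have h2 := he' k (mem_faceCompl.1 hk)
  simp [expS_apply] at h1
  omega

/-- A set of d - t + 1 indices meets the first t, so the target vanishes and every cochain of degree
d - t is a cocycle. -/
theorem cechD_faceRing_eq_zero {t : ℕ} (ht : t ≤ d) {i j : ℤ} (h : i + 1 = j) (hi : i = d - t)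
    (f : ((faceRing K W t).cech i).carrier) : (faceRing K W t).cechD h f = 0 := by
  funext T
  have : ∃ j ∈ T.1, j.val < t := by
    by_contra! hc
    have h1 := Finset.card_le_card (s := T.1) (t := faceCompl d t)
      fun j hj => mem_faceCompl.2 (hc j hj)
    have h2 := T.2
    have h3 := card_faceCompl ht
    omega
  obtain ⟨j, hj, hjt⟩ := this
  exact cechTerm_faceRing_eq_zero hj hjt _

theorem cech_faceRing_ext {t : ℕ} (ht : t ≤ d) {f g : ((faceRing K W t).cech (d - t)).carrier}
    (h : f ⟨faceCompl d t, card_faceCompl ht⟩ = g ⟨faceCompl d t, card_faceCompl ht⟩) : f = g := by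
  funext T
  by_cases hT : ∀ j ∈ T.1, t ≤ j.val
  · obtain ⟨T, hT'⟩ := T
    obtain rfl := eq_faceCompl_of_card ht hT' hT
    exact h
  · push Not at hT
    obtain ⟨j, hj, hjt⟩ := hT
    exact (cechTerm_faceRing_eq_zero hj hjt _).trans (cechTerm_faceRing_eq_zero hj hjt _).symm

/-- The cochain with the component `p / (∏_{j ≥ t} x_j) ^ n`. -/
noncomputable def topCochain (K : Type u) [Field K] {m d : ℕ} (W : Matrix (Fin m) (Fin d) ℤ)
    {t : ℕ} (ht : t ≤ d) (n : ℕ) :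
    MvPolynomial (Fin d) K →ₗ[MvPolynomial (Fin d) K] ((faceRing K W t).cech (d - t)).carrier :=
  LinearMap.single (MvPolynomial (Fin d) K)
    (fun S : {S : Finset (Fin d) // (S.card : ℤ) = d - t} =>
      ((faceRing K W t).cechTerm S.1).carrier) ⟨faceCompl d t, card_faceCompl ht⟩ ∘ₗ
    fracMap K W t (faceCompl d t) n

theorem topCochain_apply {t : ℕ} (ht : t ≤ d) (n : ℕ) (p : MvPolynomial (Fin d) K) :
    topCochain K W ht n p ⟨faceCompl d t, card_faceCompl ht⟩ = fracMap K W t (faceCompl d t) n p :=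
  Pi.single_eq_same _ _

/-- The class of `p / (∏_{j ≥ t} x_j) ^ n` in `Q_t`. -/
noncomputable def fracClass (K : Type u) [Field K] {m d : ℕ} (W : Matrix (Fin m) (Fin d) ℤ)
    {t : ℕ} (ht : t ≤ d) (n : ℕ) :
    MvPolynomial (Fin d) K →ₗ[MvPolynomial (Fin d) K] (Q K W t).carrier :=
  Submodule.mkQ _ ∘ₗ LinearMap.codRestrict _ (topCochain K W ht n)
    fun _ => cechD_faceRing_eq_zero ht rfl rfl _

theorem fracClass_eq_zero_iff_exists {t : ℕ} (ht : t ≤ d) {n : ℕ} {p : MvPolynomial (Fin d) K} :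
    fracClass K W ht n p = 0 ↔
      ∃ g, (faceRing K W t).cechD (sub_add_cancel ((d : ℤ) - t) 1) g = topCochain K W ht n p :=
  Submodule.Quotient.mk_eq_zero _

theorem noPolarPart_of_fracClass_eq_zero {t : ℕ} (ht : t ≤ d) {n : ℕ} {p : MvPolynomial (Fin d) K}
    (h : fracClass K W ht n p = 0) : NoPolarPart t n p := by
  obtain ⟨g, hg⟩ := (fracClass_eq_zero_iff_exists ht).1 h
  have h1 := congrFun hg ⟨faceCompl d t, card_faceCompl ht⟩
  rw [topCochain_apply, cechD_apply] at h1
  have h2 : fracMap K W t (faceCompl d t) n p ∈ noPolarPart K W t := by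
    rw [← h1]
    exact AddSubgroup.sum_mem _ fun k _ =>
      AddSubgroup.zsmul_mem _ (cechRes_mem_noPolarPart k.2 _) _
  exact h2 n p rfl

theorem fracClass_X_pow_mul_eq_zero {t : ℕ} (ht : t ≤ d) {k : Fin d} (hk : t ≤ k.val) (n : ℕ)
    (p : MvPolynomial (Fin d) K) : fracClass K W ht n (X k ^ n * p) = 0 := by
  classical
  have hk' := mem_faceCompl.2 hk
  refine (fracClass_eq_zero_iff_exists ht).2 ?_
  let a : ℤ := (-1) ^ ((faceCompl d t).filter (· < k)).card
  have ha : a * a = 1 := by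
    rw [← pow_two, ← pow_mul, mul_comm, pow_mul]
    simp
  -- Only the face omitting k contributes. Multiplying by the sign a, its own inverse, cancels the
  -- sign of the differential.
  refine ⟨Pi.single (M := fun S : {S : Finset (Fin d) // (S.card : ℤ) = (d : ℤ) - t - 1} =>
    ((faceRing K W t).cechTerm S.1).carrier)
    ⟨(faceCompl d t).erase k, card_erase_eq (sub_add_cancel _ 1) (card_faceCompl ht) hk'⟩
    (a • fracMap K W t ((faceCompl d t).erase k) n p), ?_⟩
  refine cech_faceRing_ext ht ?_
  rw [topCochain_apply, cechD_apply, Finset.sum_eq_single ⟨k, hk'⟩]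
  · rw [Pi.single_eq_same, map_zsmul, cechRes_fracMap, Finset.sdiff_erase_self hk', smul_smul, ha,
      one_smul, xS_singleton]
  · intro k' _ hne
    rw [Pi.single_eq_of_ne, map_zero]
    · exact zsmul_zero _
    intro heq
    apply hne
    apply Subtype.ext
    by_contra hc
    have h1 : k'.1 ∈ (faceCompl d t).erase k := Finset.mem_erase.2 ⟨hc, k'.2⟩
    have h2 : (faceCompl d t).erase k'.1 = (faceCompl d t).erase k := congrArg Subtype.val heq
    rw [← h2] at h1
    exact Finset.notMem_erase _ _ h1
  · exact fun h => absurd (Finset.mem_univ _) h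

/-- For the converse, argue monomial by monomial: without polar part, each one lies in F_t, so its
fraction is 0, or is divisible by some x_k^n with k outside F_t, so its fraction is a coboundary. -/
theorem fracClass_eq_zero_iff {t : ℕ} (ht : t ≤ d) {n : ℕ} {p : MvPolynomial (Fin d) K} :
    fracClass K W ht n p = 0 ↔ NoPolarPart t n p := by
  refine ⟨noPolarPart_of_fracClass_eq_zero ht, fun h => ?_⟩
  rw [p.as_sum, map_sum]
  refine Finset.sum_eq_zero fun e he => ?_
  by_cases h1 : ∀ j : Fin d, j.val < t → e j = 0
  · have h2 : ∃ k : Fin d, t ≤ k.val ∧ n ≤ e k := by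
      by_contra! hc
      exact mem_support_iff.1 he (h e h1 hc)
    obtain ⟨k, hk, hn⟩ := h2
    have : (monomial e (coeff e p) : MvPolynomial (Fin d) K) =
        X k ^ n * monomial (e - Finsupp.single k n) (coeff e p) := by
      rw [X_pow_eq_monomial, monomial_mul, one_mul, add_tsub_cancel_of_le]
      simpa using hn
    rw [this]
    exact fracClass_X_pow_mul_eq_zero ht hk n _
  · refine (fracClass_eq_zero_iff_exists ht).2 ⟨0, ?_⟩
    have : (monomial e (coeff e p) : MvPolynomial (Fin d) K) ∈ faceIdeal K d t := by
      refine mem_faceIdeal_iff.2 fun e' he' => ?_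
      rw [coeff_monomial, if_neg]
      rintro rfl
      exact h1 he'
    refine cech_faceRing_ext ht ?_
    rw [topCochain_apply, fracMap_eq_zero_of_mem _ _ this, map_zero]
    rfl

theorem fracClass_add_pow {t : ℕ} (ht : t ≤ d) (n k : ℕ) (p : MvPolynomial (Fin d) K) :
    fracClass K W ht (n + k) (xS K (faceCompl d t) ^ k * p) = fracClass K W ht n p := by
  refine congrArg (Submodule.mkQ _) (Subtype.ext (cech_faceRing_ext ht ?_))
  exact (topCochain_apply ht _ _).trans
    ((fracMap_add_pow _ n k p).trans (topCochain_apply ht _ _).symm)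

theorem exists_fracClass_eq {t : ℕ} (ht : t ≤ d) (z : (Q K W t).carrier) :
    ∃ n p, fracClass K W ht n p = z := by
  obtain ⟨f, rfl⟩ := Submodule.mkQ_surjective _ z
  obtain ⟨n, p, hp⟩ := exists_fracMap_eq (f.1 ⟨faceCompl d t, card_faceCompl ht⟩)
  refine ⟨n, p, congrArg (Submodule.mkQ _) (Subtype.ext (cech_faceRing_ext ht ?_))⟩
  exact (topCochain_apply ht _ _).trans hp

theorem exists_fracClass_eq_of_mem_gr {t : ℕ} (ht : t ≤ d) {g : Fin m → ℤ} {z : (Q K W t).carrier}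
    (hz : z ∈ (Q K W t).gr g) :
    ∃ n, ∃ p ∈ polyGr K W (g + n • ∑ j ∈ faceCompl d t, wt W j), fracClass K W ht n p = z := by
  obtain ⟨f, hf, rfl⟩ := hz
  have hf' : f.1 ∈ ((faceRing K W t).cech (d - t)).gr g := hf
  obtain ⟨n, p, hpg, hp⟩ := exists_fracMap_eq_of_mem_gr
    (mem_pi_gr.1 hf' ⟨faceCompl d t, card_faceCompl ht⟩)
  refine ⟨n, p, hpg, congrArg (Submodule.mkQ _) (Subtype.ext (cech_faceRing_ext ht ?_))⟩
  exact (topCochain_apply ht _ _).trans hp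

/-! ### The residue functional -/

/-- The residue: the coefficient of `∏_{j ≥ t} x_j⁻¹` in `p / (∏_{j ≥ t} x_j) ^ n`. -/
noncomputable def residue (t n : ℕ) (p : MvPolynomial (Fin d) K) : K :=
  -- Multiplying p by x_S replaces the exponent n - 1, whose truncation would be wrong for n = 0.
  coeff (n • expS (faceCompl d t)) (xS K (faceCompl d t) * p)

theorem residue_add (t n : ℕ) (p q : MvPolynomial (Fin d) K) :
    residue t n (p + q) = residue t n p + residue t n q := by
  rw [residue, mul_add, coeff_add, residue, residue]

theorem residue_C_mul (t n : ℕ) (a : K) (p : MvPolynomial (Fin d) K) :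
    residue t n (C a * p) = a * residue t n p := by
  rw [residue, mul_left_comm, coeff_C_mul, residue]

theorem residue_add_pow (t n k : ℕ) (p : MvPolynomial (Fin d) K) :
    residue t (n + k) (xS K (faceCompl d t) ^ k * p) = residue t n p := by
  rw [residue, mul_left_comm, xS_pow_eq, add_comm, add_smul, coeff_monomial_mul, one_mul, residue]

theorem xS_eq_monomial (S : Finset (Fin d)) : xS K S = monomial (expS S) 1 := by
  have := xS_pow_eq (K := K) S 1
  rwa [pow_one, one_smul] at this

theorem NoPolarPart.residue_eq_zero {t n : ℕ} {p : MvPolynomial (Fin d) K}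
    (hp : NoPolarPart t n p) : residue t n p = 0 := by
  rw [residue, xS_eq_monomial, coeff_monomial_mul']
  split_ifs with hle
  · rw [one_mul]
    refine hp _ (fun j hj => by simp [expS_apply, mem_faceCompl, hj.not_ge]) fun j hj => ?_
    have h1 := hle j
    simp only [Finsupp.coe_tsub, Finsupp.coe_smul, Pi.sub_apply,
      Pi.smul_apply, expS_apply, mem_faceCompl.2 hj, if_true, smul_eq_mul, mul_one] at h1 ⊢
    omega
  · rfl

/-- Over the common denominator x_S^(n+k) the difference of the numerators has no polar part, so its
residue is 0. -/
theorem residue_eq_of_fracClass_eq {t : ℕ} (ht : t ≤ d) {n k : ℕ} {p q : MvPolynomial (Fin d) K}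
    (h : fracClass K W ht n p = fracClass K W ht k q) : residue t n p = residue t k q := by
  have h1 : fracClass K W ht (n + k) (xS K (faceCompl d t) ^ k * p +
      C (-1) * (xS K (faceCompl d t) ^ n * q)) = 0 := by
    rw [C_neg, C_1, neg_one_mul, map_add, map_neg, fracClass_add_pow, add_comm n k,
      fracClass_add_pow, h, add_neg_cancel]
  have h2 := ((fracClass_eq_zero_iff ht).1 h1).residue_eq_zero
  rw [residue_add, residue_C_mul, residue_add_pow, add_comm n k, residue_add_pow, neg_one_mul,
    ← sub_eq_add_neg, sub_eq_zero] at h2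
  exact h2

theorem exists_residue_hom (K : Type u) [Field K] {m d : ℕ} (W : Matrix (Fin m) (Fin d) ℤ)
    {t : ℕ} (ht : t ≤ d) :
    ∃ r : (Q K W t).carrier →+ K, ∀ n p, r (fracClass K W ht n p) = residue t n p := by
  choose n p hp using exists_fracClass_eq (K := K) (W := W) ht
  have key : ∀ k q, residue t (n (fracClass K W ht k q)) (p (fracClass K W ht k q)) =
      residue t k q := fun k q => residue_eq_of_fracClass_eq ht (hp _)
  refine ⟨AddMonoidHom.mk' (fun z => residue t (n z) (p z)) fun z w => ?_, key⟩
  have h1 : z + w = fracClass K W ht (n z + n w) (xS K (faceCompl d t) ^ n w * p z +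
      xS K (faceCompl d t) ^ n z * p w) := by
    rw [map_add, fracClass_add_pow, add_comm (n z), fracClass_add_pow, hp, hp]
  rw [h1, key, residue_add, residue_add_pow, add_comm (n z), residue_add_pow]

theorem weight_expS (S : Finset (Fin d)) :
    Finsupp.weight (wt W) (expS S) = ∑ j ∈ S, wt W j := by
  rw [expS, map_sum]
  exact Finset.sum_congr rfl fun j _ => by rw [Finsupp.weight_single, one_smul]

/-- `Q_t` is a twist of the graded dual of `A / F_t`, by means of the residue. -/
theorem nonempty_socleFunctional_Q (K : Type u) [Field K] {m d : ℕ} (W : Matrix (Fin m) (Fin d) ℤ)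
    {t : ℕ} (ht : t ≤ d) :
    Nonempty (SocleFunctional (Q K W t) t (-∑ j ∈ faceCompl d t, wt W j)) := by
  classical
  obtain ⟨r, hr⟩ := exists_residue_hom K W ht
  have hr' : ∀ n p q, r (q • fracClass K W ht n p) = residue t n (q * p) := fun n p q => by
    rw [← map_smul, smul_eq_mul, hr]
  refine ⟨⟨r, fun a x => ?_, fun {h x} hx h0 => ?_, fun x hx => ?_, fun j hj x => ?_,
    fun n hn => ?_⟩⟩
  · obtain ⟨n, p, rfl⟩ := exists_fracClass_eq ht x
    rw [hr', residue_C_mul, hr]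
  · obtain ⟨n, p, hp, rfl⟩ := exists_fracClass_eq_of_mem_gr ht hx
    rw [hr] at h0
    have h1 := (IsWeightedHomogeneous.mul (xS_mem (K := K) (W := W) (faceCompl d t)) hp) h0
    rw [map_nsmul, weight_expS, ← add_assoc] at h1
    exact eq_neg_of_add_eq_zero_right (right_eq_add.1 h1)
  · obtain ⟨n, p, rfl⟩ := exists_fracClass_eq ht x
    refine (fracClass_eq_zero_iff ht).2 fun e he hen => ?_
    -- Multiplication by this monomial moves the coefficient at e to the residue position; the
    -- subtractions are exact outside F_t because e_j < n.
    have h1 := hx (n • expS (faceCompl d t) - expS (faceCompl d t) - e)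
    have h2 : n • expS (faceCompl d t) =
        expS (faceCompl d t) + ((n • expS (faceCompl d t) - expS (faceCompl d t) - e) + e) := by
      ext j
      by_cases hj : t ≤ j.val
      · have h3 := hen j hj
        simp only [Finsupp.coe_tsub, Finsupp.coe_add, Finsupp.coe_smul, Pi.sub_apply,
          Pi.add_apply, Pi.smul_apply, expS_apply, mem_faceCompl.2 hj, if_true, smul_eq_mul,
          mul_one]
        omega
      · simp [expS_apply, mem_faceCompl, hj, he j (not_le.1 hj)]
    rw [hr', residue, xS_eq_monomial] at h1
    nth_rewrite 1 [h2] at h1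
    rwa [coeff_monomial_mul, one_mul, coeff_monomial_mul, one_mul] at h1
  · obtain ⟨n, p, rfl⟩ := exists_fracClass_eq ht x
    rw [← map_smul, fracClass_eq_zero_iff, smul_eq_mul]
    exact fun e he _ => mem_faceIdeal_iff.1
      (Ideal.mul_mem_right p _ (X_mem_faceIdeal hj)) e he
  -- The dual element is x^(-n)/x_S, written with denominator x_S^N; this N exceeds every exponent
  -- of n, so the numerator exponent q exists.
  · set N := n.degree + 1
    obtain ⟨q, hq⟩ : ∃ q, N • expS (faceCompl d t) = expS (faceCompl d t) +
        (n + q) := by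
      refine ⟨N • expS (faceCompl d t) - expS (faceCompl d t) - n, ?_⟩
      ext j
      by_cases hj : t ≤ j.val
      · have h3 : n j ≤ n.degree := Finsupp.le_degree j n
        simp only [Finsupp.coe_tsub, Finsupp.coe_add, Finsupp.coe_smul, Pi.sub_apply,
          Pi.add_apply, Pi.smul_apply, expS_apply, mem_faceCompl.2 hj, if_true, smul_eq_mul,
          mul_one]
        omega
      · simp [expS_apply, mem_faceCompl, hj, hn j (not_le.1 hj)]
    refine ⟨fracClass K W ht N (monomial q 1), fun n' => ?_⟩
    rw [hr', residue, xS_eq_monomial, monomial_mul, monomial_mul, coeff_monomial, hq]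
    simp only [add_right_inj, add_left_inj, one_mul]

end TopCohomology

end GrMod

end GradedLC

/-! ### The theorem -/

open GradedLC GradedLC.GrMod in
theorem mainTheorem12 {K : Type u} [Field K] {m d : ℕ} (W : Matrix (Fin m) (Fin d) ℤ)
    (hW : IsPositiveType W) (t : ℕ) (ht1 : 1 ≤ t) (ht : t < d) :
    -- multiplication by `x_{t+1}` fits into a short exact sequence
    -- `0 → Q_{t+1}(c_{t+1}) → Q_t → Q_t(c_{t+1}) → 0`
    (∃ β : ((Q K W (t + 1)).shift (wt W ⟨t, ht⟩)).carrier →ₗ[MvPolynomial (Fin d) K]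
        (Q K W t).carrier,
      IsShortExact β ((Q K W t).mulShift (X ⟨t, ht⟩) (wt W ⟨t, ht⟩))) ∧
    -- the class of any such sequence is a free generator
    (∀ (β : ((Q K W (t + 1)).shift (wt W ⟨t, ht⟩)).carrier →ₗ[MvPolynomial (Fin d) K]
        (Q K W t).carrier)
      (h : IsShortExact β ((Q K W t).mulShift (X ⟨t, ht⟩) (wt W ⟨t, ht⟩))),
      ∃ e : Iso (faceRing K W (t + 1))
          (gExt1 ((Q K W t).shift (wt W ⟨t, ht⟩)) ((Q K W (t + 1)).shift (wt W ⟨t, ht⟩))),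
        e.toEquiv (Ideal.Quotient.mk (faceIdeal K d (t + 1)) 1) = extClass h) ∧
    -- the same group without the twist of the second argument
    Nonempty (Iso ((faceRing K W (t + 1)).shift (-wt W ⟨t, ht⟩))
      (gExt1 ((Q K W t).shift (wt W ⟨t, ht⟩)) (Q K W (t + 1)))) := by
  obtain ⟨ε⟩ := nonempty_socleFunctional_Q K W ht.le
  obtain ⟨ε₁⟩ := nonempty_socleFunctional_Q K W (Nat.succ_le_of_lt ht)
  -- The twist by c_{t+1} places the functional of Q_{t+1} in the same degree as that of Q_t, which
  -- is what makes β degree-preserving.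
  have hs : (-∑ j ∈ faceCompl d (t + 1), wt W j) - wt W ⟨t, ht⟩ =
      -∑ j ∈ faceCompl d t, wt W j := by
    have : faceCompl d t = insert ⟨t, ht⟩ (faceCompl d (t + 1)) := by
      ext j
      rw [Finset.mem_insert, mem_faceCompl, mem_faceCompl, Fin.ext_iff]
      change t ≤ j.val ↔ j.val = t ∨ t + 1 ≤ j.val
      omega
    rw [this, Finset.sum_insert (by simp [mem_faceCompl])]
    abel
  have ε' := ε₁.shift (wt W ⟨t, ht⟩)
  rw [Nat.succ_eq_add_one, hs] at ε'
  have hex := ε.exists_isShortExact hW ht ε'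
  have hiso := fun β h => exists_iso_gExt1 (β := β) ht hW ε' ε.X_smul h
  refine ⟨hex, hiso, ?_⟩
  obtain ⟨β, h⟩ := hex
  obtain ⟨e, -⟩ := hiso β h
  obtain ⟨f⟩ := nonempty_iso_gExt1_shift ((Q K W t).shift (wt W ⟨t, ht⟩)) (Q K W (t + 1))
    (wt W ⟨t, ht⟩)
  exact ⟨(e.trans f).unshift⟩
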